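/- Let $f\colon(\mathbb{F}_2)^4\to(\mathbb{F}_2)^4$, let $\hat f_u(x)=f(x+u)+f(x)$ for $u\in(\mathbb{F}_2)^4$, let $\langle f,v\rangle$ denote the Boolean function $x\mapsto\langle f(x),v\rangle$ (standard scalar product), and let $\mathrm{w}$ be the Hamming weight. For a Boolean function $g\colon(\mathbb{F}_2)^4\to\mathbb{F}_2$ let $\deg g$ be the degree of its algebraic normal form and let $g^{\mathcal W}(a)=\sum_{x\in(\mathbb{F}_2)^4}(-1)^{g(x)+\langle a,x\rangle}$. Put $$\mathrm{Lin}(f)=\max_{a,\;b\neq 0}\bigl|\langle f,b\rangle^{\mathcal W}(a)\bigr|,\qquad \mathrm{Lin}_1(f)=\max_{\mathrm{w}(a)=\mathrm{w}(b)=1}\bigl|\langle f,b\rangle^{\mathcal W}(a)\bigr|,$$ $$\mathrm{Diff}_1(f)=\max_{\mathrm{w}(a)=\mathrm{w}(b)=1}\bigl|\hat f_a^{-1}(b)\bigr|,\qquad n_3(f)=\bigl|\{v\in(\mathbb{F}_2)^4\setminus\{0\}:\deg\langle f,v\rangle=3\}\bigr|.$$ Call a permutation $f$ of $(\mathbb{F}_2)^4$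 a strong S-Box if $f$ is weakly APN (that is, $|\mathrm{Im}(\hat f_u)|>2^{3}/2=4$ for every $u\neq0$) and $4$-differentially uniform (that is, $|\hat f_u^{-1}(v)|\le4$ for all $u\ne0$ and all $v$), and $\mathrm{Lin}(f)=8$, $\mathrm{Diff}_1(f)=0$, $\mathrm{Lin}_1(f)=4$, $n_3(f)\ge14$. Call $f$ very strong if it is strong and, in addition, strongly $2$-anti-invariant: whenever $V,W$ are linear subspaces of $(\mathbb{F}_2)^4$ with $f(V)=W$, either $\dim V=\dim W<2$ or $V=W=(\mathbb{F}_2)^4$. Then, among the permutations $f$ of $(\mathbb{F}_2)^4$ with $f(0)=0$, exactly $55296$ are strong S-Boxes and exactly $2304$ are very strong. -/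

import Mathlib

namespace SBox

/-- The space `(𝔽₂)^m`. -/
abbrev Vec (m : ℕ) : Type := Fin m → ZMod 2

variable {m : ℕ}

/-- The derivative `x ↦ f (x + u) + f x` of `f` in direction `u`. -/
def derivative (f : Vec m → Vec m) (u : Vec m) : Vec m → Vec m :=
  fun x => f (x + u) + f x

/-- The component `⟨f, v⟩ : x ↦ ⟨f x, v⟩`, with respect to the standard scalar product. -/
def component (f : Vec m → Vec m) (v : Vec m) : Vec m → ZMod 2 :=
  fun x => f x ⬝ᵥ v

/-- `f` is `δ`-differentially uniform. -/
def DifferentiallyUniform (δ : ℕ) (f : Vec m → Vec m) : Prop :=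
  ∀ u : Vec m, u ≠ 0 → ∀ v : Vec m,
    (Finset.univ.filter fun x : Vec m => derivative f u x = v).card ≤ δ

/-- `f` is weakly `δ`-differentially uniform: every derivative in a nonzero direction has more than
`2 ^ (m - 1) / δ` values (a fraction; for `m = 0` there is no nonzero direction). -/
def WeaklyDifferentiallyUniform (δ : ℕ) (f : Vec m → Vec m) : Prop :=
  ∀ u : Vec m, u ≠ 0 →
    (2 : ℚ) ^ (m - 1) / (δ : ℚ) < ((Finset.univ.image (derivative f u)).card : ℚ)

/-- Weakly almost perfectly nonlinear functions. -/
def WeaklyAPN (f : Vec m → Vec m) : Prop :=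
  WeaklyDifferentiallyUniform 2 f

/-- `f` is strongly `l`-anti-invariant: if `f` maps a subspace `V` onto a subspace `W`, then
`dim V = dim W < m - l` or `V = W` is the whole space. -/
def StronglyAntiInvariant (l : ℕ) (f : Vec m → Vec m) : Prop :=
  ∀ V W : Submodule (ZMod 2) (Vec m), f '' (V : Set (Vec m)) = (W : Set (Vec m)) →
    (Module.finrank (ZMod 2) V = Module.finrank (ZMod 2) W ∧
        Module.finrank (ZMod 2) W + l < m) ∨
      (V = ⊤ ∧ W = ⊤)

/-- The Walsh coefficient of a Boolean function `g` at `a`: the sum over all `x` of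
`(-1) ^ (g x + ⟨a, x⟩)`. -/
def walsh (g : Vec m → ZMod 2) (a : Vec m) : ℤ :=
  ∑ x : Vec m, (-1) ^ (g x + a ⬝ᵥ x).val

/-- `Lin f`, the maximum of `|⟨f, b⟩^W (a)|` over all `a` and all `b ≠ 0`. -/
def Lin (f : Vec m → Vec m) : ℕ :=
  (Finset.univ.filter fun p : Vec m × Vec m => p.2 ≠ 0).sup
    fun p => (walsh (component f p.2) p.1).natAbs

/-- `Lin₁ f`, the maximum of `|⟨f, b⟩^W (a)|` over all `a`, `b` of Hamming weight one. -/
def Lin₁ (f : Vec m → Vec m) : ℕ :=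
  (Finset.univ.filter fun p : Vec m × Vec m => hammingNorm p.1 = 1 ∧ hammingNorm p.2 = 1).sup
    fun p => (walsh (component f p.2) p.1).natAbs

/-- `Diff₁ f`, the maximum over all `a`, `b` of Hamming weight one of the number of `x` at which
the derivative in direction `a` takes the value `b`. -/
def Diff₁ (f : Vec m → Vec m) : ℕ :=
  (Finset.univ.filter fun p : Vec m × Vec m => hammingNorm p.1 = 1 ∧ hammingNorm p.2 = 1).sup
    fun p => (Finset.univ.filter fun x : Vec m => derivative f p.1 x = p.2).card

/-- The vector with support `J`. -/
def indicatorVec (J : Finset (Fin m)) : Vec m :=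
  fun i => if i ∈ J then 1 else 0

/-- The coefficient of the monomial `∏ i ∈ I, x i` in the algebraic normal form of `g`,
the unique representation of `g` as a square-free polynomial (see `anfCoeff_unique`). -/
def anfCoeff (g : Vec m → ZMod 2) (I : Finset (Fin m)) : ZMod 2 :=
  ∑ J ∈ I.powerset, g (indicatorVec J)

theorem sum_powerset_sum_powerset (a : Finset (Fin m) → ZMod 2) (S : Finset (Fin m)) :
    ∑ I ∈ S.powerset, ∑ J ∈ I.powerset, a J = a S := by
  have h : ∑ I ∈ S.powerset, ∑ J ∈ I.powerset, a J
      = ∑ J ∈ S.powerset, ∑ I ∈ Finset.Icc J S, a J := by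
    apply Finset.sum_comm'
    intro I J
    simp only [Finset.mem_powerset, Finset.mem_Icc]
    constructor
    · rintro ⟨h1, h2⟩
      exact ⟨⟨h2, h1⟩, h2.trans h1⟩
    · rintro ⟨⟨h1, h2⟩, _⟩
      exact ⟨h2, h1⟩
  rw [h, Finset.sum_eq_single S]
  · simp
  · intro J hJ hne
    have hJS : J ⊆ S := Finset.mem_powerset.mp hJ
    have hlt : J.card < S.card := Finset.card_lt_card (Finset.ssubset_iff_subset_ne.mpr ⟨hJS, hne⟩)
    rw [Finset.sum_const, Finset.card_Icc_finset hJS]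
    obtain ⟨k, hk⟩ : ∃ k, S.card - J.card = k + 1 := ⟨S.card - J.card - 1, by omega⟩
    have h2 : (2 : ZMod 2) = 0 := by decide
    rw [hk, nsmul_eq_mul]
    push_cast
    rw [h2]
    simp
  · intro hS
    simp at hS

theorem sum_prod_indicatorVec (c : Finset (Fin m) → ZMod 2) (S : Finset (Fin m)) :
    ∑ I, c I * ∏ i ∈ I, indicatorVec S i = ∑ I ∈ S.powerset, c I := by
  have h : ∀ I : Finset (Fin m),
      c I * ∏ i ∈ I, indicatorVec S i = if I ∈ S.powerset then c I else 0 := by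
    intro I
    by_cases hI : I ⊆ S
    · rw [if_pos (Finset.mem_powerset.mpr hI), Finset.prod_eq_one, mul_one]
      intro i hi
      simp [indicatorVec, hI hi]
    · rw [if_neg (fun h => hI (Finset.mem_powerset.mp h))]
      obtain ⟨i, hi, hiS⟩ := Finset.not_subset.mp hI
      rw [Finset.prod_eq_zero hi (by simp [indicatorVec, hiS]), mul_zero]
  rw [Finset.sum_congr rfl fun I _ => h I, Finset.sum_ite_mem, Finset.univ_inter]

theorem indicatorVec_support (x : Vec m) :
    indicatorVec (Finset.univ.filter fun i => x i ≠ 0) = x := by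
  have h : ∀ z : ZMod 2, (if z ≠ 0 then (1 : ZMod 2) else 0) = z := by decide
  funext i
  simpa [indicatorVec] using h (x i)

/-- `anfCoeff g` is the one and only family of coefficients of a square-free polynomial that
represents `g`. -/
theorem anfCoeff_unique (g : Vec m → ZMod 2) (c : Finset (Fin m) → ZMod 2) :
    (∀ x, g x = ∑ I, c I * ∏ i ∈ I, x i) ↔ c = anfCoeff g := by
  constructor
  · intro h
    funext S
    have h2 : ∀ J : Finset (Fin m), g (indicatorVec J) = ∑ I ∈ J.powerset, c I := fun J => by
      rw [h, sum_prod_indicatorVec]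
    simp only [anfCoeff, h2, sum_powerset_sum_powerset]
  · rintro rfl x
    rw [← indicatorVec_support x, sum_prod_indicatorVec]
    exact (sum_powerset_sum_powerset (fun J => g (indicatorVec J)) _).symm

/-- The algebraic degree of a Boolean function, that is the degree of its algebraic normal form
(with value `0` at the zero function). -/
def degree (g : Vec m → ZMod 2) : ℕ :=
  (Finset.univ.filter fun I : Finset (Fin m) => anfCoeff g I ≠ 0).sup Finset.card

/-- `numDegree i f` is `nᵢ(f)`, the number of nonzero `v` for which `⟨f, v⟩` has degree `i`. -/
def numDegree (i : ℕ) (f : Vec m → Vec m) : ℕ :=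
  (Finset.univ.filter fun v : Vec m => v ≠ 0 ∧ degree (component f v) = i).card

/-- Strong S-Boxes on four bits. -/
structure IsStrong (f : Vec 4 → Vec 4) : Prop where
  bijective : Function.Bijective f
  weaklyAPN : WeaklyAPN f
  differentiallyUniform : DifferentiallyUniform 4 f
  lin_eq : Lin f = 8
  diff₁_eq : Diff₁ f = 0
  lin₁_eq : Lin₁ f = 4
  le_numDegree : 14 ≤ numDegree 3 f

/-- Very strong S-Boxes on four bits. -/
structure IsVeryStrong (f : Vec 4 → Vec 4) : Prop where
  isStrong : IsStrong f
  stronglyAntiInvariant : StronglyAntiInvariant 2 f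

end SBox

/-! The count is an exhaustive search, pruned by differences and shortened by symmetry.

Regard the graph of `f` as a set of points of 𝔽₂⁸, the pair (x, y) having the code `16 * x + y`. For
u ≠ 0 the derivative in direction u takes the value v exactly twice for each unordered pair of graph
points with difference (u, v). Hence injectivity, `Diff₁ f = 0` and 4-differential uniformity
together say that certain differences never occur and that no difference belongs to more than two
pairs. This property, `Admissible`, passes to subsets of the graph, so a partial graph that violates
it has no strong extension (`IsStrong.admissible`). Backtracking over the values therefore computes
exact sums over all extensions. The inductive step is `Computes.node`, where a single addition of
long numbers decides admissibility for all sixteen candidate values at once (`testBit_free`). At a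
complete graph the remaining conditions are read off truth tables (`computes_leaf`).

For a strong `f` fixing 0, strong 2-anti-invariance amounts to `MapsNoPlane`. Indeed a hyperplane
mapped onto a hyperplane would produce a Walsh coefficient 16, while `Lin f = 8`; only planes
remain, and a plane {0, a, b, a + b} goes onto a plane precisely when f a + f b = f (a + b).

Permuting the coordinates of the argument and of the value preserves all conditions
(`indicator_act`). A strong `f` fixing 0 sends the unit vectors to four distinct vectors of weight
at least two. Permutations of the argument identify the 24 orders of these four values
(`sumOnto_image`), and permutations of the value reduce the 330 possible sets to 28 representatives
(`sumOnto_permuteBits`, `sum_find`), with one search for each. Both counts travel in one number,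
strong + 2^65 · very strong; they can be separated at the end because there are only 2^64 functions.
-/

namespace SBox

/-! ### The search

Functions on `Vec 4` are handled through codes: a vector is a number below `16`, and the pair of a
point `x` and its value `y` is the number `16 * x + y`. A partial function is a list of such codes,
and the sum of two codes is their bitwise exclusive or. -/

/-- The concatenation of the `256`-bit blocks `h 0, …, h (n - 1)`. -/
noncomputable def blocks (h : ℕ → ℕ) (n : ℕ) : ℕ :=
  Nat.rec 0 (fun n ih => Nat.add ih (Nat.shiftLeft (h n) (Nat.mul 256 n))) n

noncomputable def ones : ℕ := blocks (fun _ => 1) 16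

noncomputable def blockMask : ℕ := Nat.sub (Nat.shiftLeft 1 256) 1

/-- Adding `2 ^ 256 - 2` to an even block overflows exactly when the block is nonzero; the 2 that is
missing leaves room for what arrives from the lower blocks. -/
noncomputable def carryMask : ℕ := blocks (fun _ => Nat.sub blockMask 1) 16

/-- Block `y` of `translates a` has its only bit at `y ^^^ a`. -/
noncomputable def translates (a : ℕ) : ℕ :=
  blocks (fun y => Nat.shiftLeft 1 (Nat.xor y a)) 16

/-- Since 2^(2s) - 1 = (2^s - 1)(2^s + 1), the quotient repeats `s` ones followed by `s` zeros. For
the powers of two in use it marks the positions whose binary digit of weight `s` is zero. -/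
noncomputable def swapMask (s : ℕ) : ℕ :=
  Nat.div (Nat.sub (Nat.shiftLeft 1 4096) 1) (Nat.add (Nat.shiftLeft 1 s) 1)

/-- For `s = 2 ^ j` this moves bit `i` to `i ^^^ s`. -/
noncomputable def swap (s Z : ℕ) : ℕ :=
  Nat.lor (Nat.land (Nat.shiftRight Z s) (swapMask s)) (Nat.shiftLeft (Nat.land Z (swapMask s)) s)

/-- Bit `256 * y` tells whether block `y` of `X` is disjoint from `F`. -/
noncomputable def free (X F : ℕ) : ℕ :=
  Nat.xor (Nat.land (Nat.shiftRight (Nat.add (Nat.land X (Nat.mul F ones)) carryMask) 256) ones)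
    ones

/-- A search procedure takes the forbidden differences `F`, the differences `S` that occur, the
translates `Z` of the graph and the list of codes chosen so far. -/
abbrev Search : Type := ℕ → ℕ → ℕ → List ℕ → ℕ

/-- `P` holds the differences between the new code `w` and `G`. Those already in `S` now belong to
two pairs and become forbidden, as a third pair would give six solutions. `K` holds the translates
of `w`. -/
noncomputable def extend (k : Search) (F S Z : ℕ) (G : List ℕ) (P K w : ℕ) : ℕ :=
  k (Nat.lor F (Nat.land P S)) (Nat.lor S P) (Nat.lor Z K) (w :: G)

noncomputable def child (k : Search) (a F S Z : ℕ) (G : List ℕ) (X y : ℕ) : ℕ :=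
  extend k F S Z G (Nat.land (Nat.shiftRight X (Nat.mul 256 y)) blockMask)
    (Nat.shiftLeft (translates y) a) (Nat.add a y)

noncomputable def point (y : ℕ) : ℕ := Nat.shiftLeft 1 (Nat.mul 256 y)

noncomputable def points (g : ℕ) : ℕ := Nat.shiftLeft (blocks (fun _ => 1) 4) (Nat.mul 1024 g)

/-- `Nat.rec` acts as a test for zero whose unused branch need not be evaluated. `pickFour` and
`pickAll` discard four or all sixteen candidates by the same device. -/
noncomputable def pick (C : ℕ) (c : ℕ → ℕ) (y r : ℕ) : ℕ :=
  Nat.rec r (fun _ _ => Nat.add (c y) r) (Nat.land C (point y))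

noncomputable def pickFour (C : ℕ) (c : ℕ → ℕ) (g y₀ y₁ y₂ y₃ r : ℕ) : ℕ :=
  Nat.rec r (fun _ _ => pick C c y₀ (pick C c y₁ (pick C c y₂ (pick C c y₃ r))))
    (Nat.land C (points g))

/-- The sum of `c y` over the `y` for which bit `256 * y` of `C` is set. -/
noncomputable def pickAll (c : ℕ → ℕ) (C : ℕ) : ℕ :=
  Nat.rec 0 (fun _ _ => pickFour C c 0 0 1 2 3 (pickFour C c 1 4 5 6 7
    (pickFour C c 2 8 9 10 11 (pickFour C c 3 12 13 14 15 0)))) C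

noncomputable def branch (k : Search) (a F S Z : ℕ) (G : List ℕ) (X : ℕ) : ℕ :=
  pickAll (child k a F S Z G X) (free X F)

/-- Choose the value at `a / 16`; `t` is the translation by `a`. -/
noncomputable def node (k : Search) (t : ℕ → ℕ) (a : ℕ) : Search :=
  fun F S Z G => branch k a F S Z G (t Z)

/-! ### The test at the leaves -/

noncomputable def allOf (p : ℕ → Bool) (l : List ℕ) : Bool :=
  List.rec true (fun a _ ih => Bool.rec false ih (p a)) l

noncomputable def anyOf (p : ℕ → Bool) (l : List ℕ) : Bool :=
  List.rec false (fun a _ ih => Bool.rec ih true (p a)) l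

noncomputable def countOf (p : ℕ → Bool) (l : List ℕ) : ℕ :=
  List.rec 0 (fun a _ ih => Bool.rec ih (Nat.succ ih) (p a)) l

/-- The list of the numbers from `1` to `15`. -/
def nonzero : List ℕ := [1, 2, 3, 4, 5, 6, 7, 8, 9, 10, 11, 12, 13, 14, 15]

/-- 27030 is 0x6996, whose bit `n` is the parity of the digit sum of `n`, for `n` below 16. -/
noncomputable def parity (n : ℕ) : ℕ := Nat.land (Nat.shiftRight 27030 n) 1

/-- The table of the linear function `x ↦ ⟨a, x⟩`. -/
noncomputable def linearTable (a : ℕ) : ℕ :=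
  List.rec 0 (fun x _ ih => Nat.lor (Nat.shiftLeft (parity (Nat.land a x)) x) ih) (0 :: nonzero)

/-- The table of the component `⟨f, b⟩` of the function with graph `G`. -/
noncomputable def componentTable (G : List ℕ) (b : ℕ) : ℕ :=
  List.rec 0 (fun w _ ih =>
    Nat.lor (Nat.shiftLeft (parity (Nat.land (Nat.land w 15) b)) (Nat.shiftRight w 4)) ih) G

/-- The number of bits of a number, by a fold over positions. -/
noncomputable def bitCount (l : List ℕ) (n : ℕ) : ℕ :=
  countOf (fun i => Nat.beq (Nat.land (Nat.shiftRight n i) 1) 1) l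

noncomputable def byteTable : ℕ :=
  Nat.rec 0 (fun n ih => Nat.lor ih (Nat.shiftLeft (bitCount [0, 1, 2, 3, 4, 5, 6, 7] n)
    (Nat.mul 4 n))) 256

/-- The number of bits of a number below `2 ^ 16`. -/
noncomputable def weight (n : ℕ) : ℕ :=
  Nat.add (Nat.land (Nat.shiftRight byteTable (Nat.mul 4 (Nat.land n 255))) 15)
    (Nat.land (Nat.shiftRight byteTable (Nat.mul 4 (Nat.shiftRight n 8))) 15)

/-- One of the two truncated differences vanishes, so the sum is |16 - 2 · weight|. -/
noncomputable def absWalsh (t a : ℕ) : ℕ :=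
  (fun p => Nat.add (Nat.sub 16 p) (Nat.sub p 16)) (Nat.mul 2 (weight (Nat.xor t (linearTable a))))

/-- The sixteen bits of `S` from `16 * u` on mark the values of the derivative in direction `u`. -/
noncomputable def testAPN (S : ℕ) : Bool :=
  allOf (fun u => Nat.ble 5 (weight (Nat.land (Nat.shiftRight S (Nat.mul 16 u)) 65535))) nonzero

noncomputable def testLin (G : List ℕ) : Bool :=
  allOf (fun b => allOf (fun a => Nat.ble (absWalsh (componentTable G b) a) 8) (0 :: nonzero))
    nonzero

noncomputable def testLin' (G : List ℕ) : Bool :=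
  anyOf (fun b => anyOf (fun a => Nat.beq (absWalsh (componentTable G b) a) 8) (0 :: nonzero))
    nonzero

noncomputable def testLin₁ (G : List ℕ) : Bool :=
  allOf (fun b => allOf (fun a => Nat.ble (absWalsh (componentTable G b) a) 4) [1, 2, 4, 8])
    [1, 2, 4, 8]

noncomputable def testLin₁' (G : List ℕ) : Bool :=
  anyOf (fun b => anyOf (fun a => Nat.beq (absWalsh (componentTable G b) a) 4) [1, 2, 4, 8])
    [1, 2, 4, 8]

/-- The tables of `x ↦ 1 + x i`. -/
def halfTables : List ℕ := [21845, 13107, 3855, 255]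

/-- A component of a permutation has degree at most three, so only the cubic coefficients matter.
The one that omits xᵢ is the parity of the number of ones on the half xᵢ = 0. -/
noncomputable def testDegree (G : List ℕ) : Bool :=
  Nat.ble 14 (countOf (fun b => anyOf (fun m =>
    Nat.beq (Nat.land (weight (Nat.land (componentTable G b) m)) 1) 1) halfTables) nonzero)

noncomputable def graphMask (G : List ℕ) : ℕ :=
  List.rec 0 (fun w _ ih => Nat.lor (Nat.shiftLeft 1 w) ih) G

/-- With `f` fixing 0, f a + f b = f (a + b) says that the sum of two graph points is again a graph
point. The code 0 is the point (0, 0). -/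
noncomputable def testPlanes (G : List ℕ) : Bool :=
  allOf (fun v => Bool.rec (allOf (fun w => Bool.rec (Bool.rec
    (Nat.beq (Nat.land (Nat.shiftRight (graphMask G) (Nat.xor v w)) 1) 0)
      true (Nat.beq v w)) true (Nat.beq w 0)) G) true (Nat.beq v 0)) G

/-- The weight is 2^65 + 1 because a very strong function is also counted as strong. Bijectivity,
4-uniformity and `Diff₁ f = 0` are not tested: the pruning ensures them. -/
noncomputable def leaf : Search := fun _ S _ G =>
  Bool.rec 0 (Bool.rec 0 (Bool.rec 0 (Bool.rec 0 (Bool.rec 0 (Bool.rec 0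
    (Bool.rec 1 36893488147419103233 (testPlanes G))
    (testLin₁' G)) (testLin' G)) (testLin G)) (testLin₁ G)) (testDegree G)) (testAPN S)

/-! ### The tree of positions -/

/-- The outermost node fixes the value at 3, the innermost the value at 15; 0 and the unit vectors
already have theirs. Translation by `16 * x` takes one swap for each nonzero binary digit of `x`. -/
noncomputable def search : Search :=
  node (node (node (node (node (node (node (node (node (node (node leaf
    (fun Z => swap 16 (swap 32 (swap 64 (swap 128 Z)))) 240)
    (fun Z => swap 32 (swap 64 (swap 128 Z))) 224)
    (fun Z => swap 16 (swap 64 (swap 128 Z))) 208)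
    (fun Z => swap 64 (swap 128 Z)) 192)
    (fun Z => swap 16 (swap 32 (swap 128 Z))) 176)
    (fun Z => swap 32 (swap 128 Z)) 160)
    (fun Z => swap 16 (swap 128 Z)) 144)
    (fun Z => swap 16 (swap 32 (swap 64 Z))) 112)
    (fun Z => swap 32 (swap 64 Z)) 96)
    (fun Z => swap 16 (swap 64 Z)) 80)
    (fun Z => swap 16 (swap 32 Z)) 48

noncomputable def differences (G : List ℕ) (w : ℕ) : ℕ :=
  List.rec 0 (fun v _ ih => Nat.lor (Nat.shiftLeft 1 (Nat.xor w v)) ih) G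

/-- Run `k` on the extension of `G` by the codes in `l`. -/
noncomputable def begin (k : Search) (l : List ℕ) : Search :=
  List.rec k (fun w _ ih F S Z G => Nat.rec
    (extend ih F S Z G (differences G w) (Nat.shiftLeft (translates (Nat.land w 15))
      (Nat.mul 16 (Nat.shiftRight w 4))) w) (fun _ _ => 0) (Nat.land (differences G w) F)) l

/-- The differences that never occur: those with exactly one of the two halves zero, and those with
both halves of weight one. -/
noncomputable def forbidden : ℕ :=
  0x100010001000100010001000101170001000100010117000101170117fffe

noncomputable def countFrom (a b c d : ℕ) : ℕ :=
  begin search [0, Nat.add 16 a, Nat.add 32 b, Nat.add 64 c, Nat.add 128 d] forbidden 0 0 []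

/-- The second component is the result of the search that starts from the first one. -/
noncomputable def isResult (r : (ℕ × ℕ × ℕ × ℕ) × ℕ) : Bool :=
  Nat.beq (countFrom r.1.1 r.1.2.1 r.1.2.2.1 r.1.2.2.2) r.2

/-! ### The twenty-eight searches -/

theorem isResult_3_5_6_7 : isResult ((3, 5, 6, 7), 18) = true := by
  decide +kernel

/-- The value is 2 · 2^65 + 10: ten strong functions, two of them very strong. -/
theorem isResult_3_5_6_9 : isResult ((3, 5, 6, 9), 73786976294838206474) = true := by
  decide +kernel

theorem isResult_3_5_6_11 : isResult ((3, 5, 6, 11), 8) = true := by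
  decide +kernel

theorem isResult_3_5_6_15 : isResult ((3, 5, 6, 15), 0) = true := by
  decide +kernel

theorem isResult_3_5_7_9 : isResult ((3, 5, 7, 9), 4) = true := by
  decide +kernel

theorem isResult_3_5_7_10 : isResult ((3, 5, 7, 10), 9) = true := by
  decide +kernel

theorem isResult_3_5_7_11 : isResult ((3, 5, 7, 11), 36893488147419103243) = true := by
  decide +kernel

theorem isResult_3_5_7_14 : isResult ((3, 5, 7, 14), 8) = true := by
  decide +kernel

theorem isResult_3_5_7_15 : isResult ((3, 5, 7, 15), 8) = true := by
  decide +kernel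

theorem isResult_3_5_9_14 : isResult ((3, 5, 9, 14), 0) = true := by
  decide +kernel

theorem isResult_3_5_9_15 : isResult ((3, 5, 9, 15), 0) = true := by
  decide +kernel

theorem isResult_3_5_10_12 : isResult ((3, 5, 10, 12), 0) = true := by
  decide +kernel

theorem isResult_3_5_10_13 : isResult ((3, 5, 10, 13), 6) = true := by
  decide +kernel

theorem isResult_3_5_10_15 : isResult ((3, 5, 10, 15), 2) = true := by
  decide +kernel

theorem isResult_3_5_11_13 : isResult ((3, 5, 11, 13), 8) = true := by
  decide +kernel

theorem isResult_3_5_11_14 : isResult ((3, 5, 11, 14), 4) = true := by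
  decide +kernel

theorem isResult_3_5_11_15 : isResult ((3, 5, 11, 15), 4) = true := by
  decide +kernel

theorem isResult_3_5_14_15 : isResult ((3, 5, 14, 15), 2) = true := by
  decide +kernel

theorem isResult_3_7_11_12 : isResult ((3, 7, 11, 12), 16) = true := by
  decide +kernel

theorem isResult_3_7_11_13 : isResult ((3, 7, 11, 13), 2) = true := by
  decide +kernel

theorem isResult_3_7_11_15 : isResult ((3, 7, 11, 15), 20) = true := by
  decide +kernel

theorem isResult_3_7_12_13 : isResult ((3, 7, 12, 13), 12) = true := by
  decide +kernel

theorem isResult_3_7_12_15 : isResult ((3, 7, 12, 15), 2) = true := by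
  decide +kernel

theorem isResult_3_7_13_14 : isResult ((3, 7, 13, 14), 2) = true := by
  decide +kernel

theorem isResult_3_7_13_15 : isResult ((3, 7, 13, 15), 73786976294838206476) = true := by
  decide +kernel

theorem isResult_3_13_14_15 : isResult ((3, 13, 14, 15), 16) = true := by
  decide +kernel

theorem isResult_7_11_13_14 : isResult ((7, 11, 13, 14), 0) = true := by
  decide +kernel

theorem isResult_7_11_13_15 : isResult ((7, 11, 13, 15), 0) = true := by
  decide +kernel

/-! ### Block arithmetic and the carry test -/

theorem blocks_succ (h : ℕ → ℕ) (n : ℕ) :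
    blocks h (n + 1) = 2 ^ (256 * n) * h n + blocks h n := by
  change blocks h n + h n <<< (256 * n) = _
  rw [Nat.shiftLeft_eq]
  ring

theorem blocks_lt {h : ℕ → ℕ} (n : ℕ) (hh : ∀ y, y < n → h y < 2 ^ 256) :
    blocks h n < 2 ^ (256 * n) := by
  induction n with
  | zero => change 0 < _; simp
  | succ n ih =>
    have h1 := ih fun y hy => hh y (by omega)
    have h2 := hh n (by omega)
    rw [blocks_succ, show 256 * (n + 1) = 256 * n + 256 by ring, pow_add]
    have h3 : 2 ^ (256 * n) * (h n + 1) ≤ 2 ^ (256 * n) * 2 ^ 256 := Nat.mul_le_mul_left _ h2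
    rw [mul_add] at h3
    omega

theorem testBit_blocks {h : ℕ → ℕ} {n y j : ℕ} (hh : ∀ y, y < n → h y < 2 ^ 256) (hy : y < n)
    (hj : j < 256) : (blocks h n).testBit (256 * y + j) = (h y).testBit j := by
  induction n with
  | zero => omega
  | succ n ih =>
    have h1 := blocks_lt n fun y hy => hh y (by omega)
    rw [blocks_succ, Nat.testBit_two_pow_mul_add _ h1]
    split
    · exact ih (fun y hy => hh y (by omega)) (by omega)
    · have : y = n := by omega
      subst this
      congr 1
      omega

theorem blocks_mod {h : ℕ → ℕ} {n m : ℕ} (hh : ∀ y, y < n → h y < 2 ^ 256) (hm : m ≤ n) :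
    blocks h n % 2 ^ (256 * m) = blocks h m := by
  induction n with
  | zero =>
    obtain rfl : m = 0 := by omega
    rfl
  | succ n ih =>
    rcases Nat.lt_or_ge n m with h1 | h1
    · obtain rfl : m = n + 1 := by omega
      exact Nat.mod_eq_of_lt (blocks_lt _ hh)
    · rw [blocks_succ, ← ih (fun y hy => hh y (by omega)) h1]
      obtain ⟨k, rfl⟩ := Nat.exists_eq_add_of_le h1
      rw [mul_add, pow_add, mul_assoc, Nat.mul_add_mod]

theorem mul_ones (F n : ℕ) : F * blocks (fun _ => 1) n = blocks (fun _ => F) n := by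
  induction n with
  | zero => rfl
  | succ n ih => rw [blocks_succ, blocks_succ, ← ih]; ring

theorem blockMask_eq : blockMask = 2 ^ 256 - 1 := by decide +kernel

theorem testBit_ones {y : ℕ} (hy : y < 16) : ones.testBit (256 * y) = true := by
  have := testBit_blocks (h := fun _ => 1) (j := 0) (fun _ _ => by norm_num) hy (by norm_num)
  simpa [ones] using this

/-- Adding `2 ^ 256 - 2` to an even block produces a carry if and only if the block is not zero. -/
theorem carry {H y n : ℕ} (hy : y < n)
    (hH : ∀ y, y ≤ n → (H / 2 ^ (256 * y)) % 2 = 0) :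
    (H + blocks (fun _ => 2 ^ 256 - 2) n).testBit (256 * (y + 1)) =
      decide (H / 2 ^ (256 * y) % 2 ^ 256 ≠ 0) := by
  have hh : ∀ y, y < n → (fun _ => 2 ^ 256 - 2 : ℕ → ℕ) y < 2 ^ 256 := fun _ _ => by norm_num
  set M := blocks (fun _ => 2 ^ 256 - 2) n with hM
  have hM1 : M % 2 ^ (256 * (y + 1)) = blocks (fun _ => 2 ^ 256 - 2) (y + 1) :=
    blocks_mod hh (by omega)
  have hM2 : M / 2 ^ (256 * (y + 1)) % 2 = 0 := by
    have : M.testBit (256 * (y + 1)) = false := by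
      rcases Nat.lt_or_ge (y + 1) n with h | h
      · have := testBit_blocks (j := 0) hh h (by norm_num)
        rw [Nat.add_zero] at this
        rw [hM, this]
        decide +kernel
      · apply Nat.testBit_lt_two_pow
        exact (blocks_lt n hh).trans_le (Nat.pow_le_pow_right (by norm_num) (by omega))
    rw [Nat.testBit_eq_decide_div_mod_eq, decide_eq_false_iff_not] at this
    omega
  have hH2 := hH (y + 1) (by omega)
  have hH3 := hH y (by omega)
  have hM3 := blocks_lt y fun z hz => hh z (by omega)
  rw [blocks_succ] at hM1
  generalize blocks (fun _ => 2 ^ 256 - 2) y = m at hM1 hM3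
  have hp : 2 ^ (256 * (y + 1)) = 2 ^ (256 * y) * 2 ^ 256 := by rw [mul_add, pow_add, mul_one]
  have hpos : 0 < 2 ^ (256 * y) := by positivity
  have e1 := Nat.div_add_mod H (2 ^ (256 * (y + 1)))
  have e2 := Nat.div_add_mod M (2 ^ (256 * (y + 1)))
  have e3 : H % 2 ^ (256 * (y + 1)) = 2 ^ (256 * y) * (H / 2 ^ (256 * y) % 2 ^ 256) +
      H % 2 ^ (256 * y) := by
    rw [hp, Nat.mod_mul]; ring
  have e4 := Nat.mod_lt H hpos
  have e5 : H / 2 ^ (256 * y) % 2 ^ 256 % 2 = 0 := by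
    rw [Nat.mod_mod_of_dvd _ (by norm_num)]; exact hH3
  have e6 : H / 2 ^ (256 * y) % 2 ^ 256 < 2 ^ 256 := Nat.mod_lt _ (by norm_num)
  rw [Nat.testBit_eq_decide_div_mod_eq]
  generalize H / 2 ^ (256 * y) % 2 ^ 256 = b at *
  generalize H % 2 ^ (256 * y) = r at *
  generalize H / 2 ^ (256 * (y + 1)) = qH at *
  generalize M / 2 ^ (256 * (y + 1)) = qM at *
  rw [← e1, ← e2, hM1, e3]
  set B := 2 ^ (256 * y)
  rw [hp]
  -- Since `r` and `m` are both below `B`, their sum fits into the slack `2 * B`, so a zero block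
  -- does not overflow. A nonzero even block is at least 2 and at most `2 ^ 256 - 2`, and overflows
  -- exactly once. As `qH` and `qM` are even, the bit in question is the carry itself.
  by_cases hb : b = 0
  · subst hb
    have : B * 2 ^ 256 * qH + (B * 0 + r) + (B * 2 ^ 256 * qM + (B * (2 ^ 256 - 2) + m)) =
        (r + m + B * (2 ^ 256 - 2)) + B * 2 ^ 256 * (qH + qM) := by ring
    rw [this, Nat.add_mul_div_left _ _ (by positivity), Nat.div_eq_of_lt]
    · simp; omega
    · omega
  · have : B * 2 ^ 256 * qH + (B * b + r) + (B * 2 ^ 256 * qM + (B * (2 ^ 256 - 2) + m)) =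
        (r + m + B * (b - 2)) + B * 2 ^ 256 * (qH + qM + 1) := by
      obtain ⟨c, rfl⟩ : ∃ c, b = c + 2 := ⟨b - 2, by omega⟩
      rw [Nat.add_sub_cancel]
      ring_nf
    rw [this, Nat.add_mul_div_left _ _ (by positivity), Nat.div_eq_of_lt]
    · simp [hb]; omega
    · have : B * (b - 2) ≤ B * (2 ^ 256 - 4) := Nat.mul_le_mul_left _ (by omega)
      omega

-- Masking `X` with sixteen copies of `F` leaves in block `y` the forbidden differences that the
-- value `y` would create. The difference 0 is not in `F`, which makes every block even, as `carry`
-- requires.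
set_option exponentiation.threshold 4096 in
theorem testBit_free {X F y : ℕ} (hF : F < 2 ^ 256) (hF0 : F.testBit 0 = false) (hy : y < 16) :
    (free X F).testBit (256 * y) = true ↔
      ∀ i, i < 256 → X.testBit (256 * y + i) = true → F.testBit i = false := by
  have hFF : ∀ y, y < 16 → (fun _ => F : ℕ → ℕ) y < 2 ^ 256 := fun _ _ => hF
  have hfree : free X F = (((X &&& F * ones) + carryMask) >>> 256 &&& ones) ^^^ ones := rfl
  have hmask : carryMask = blocks (fun _ => 2 ^ 256 - 2) 16 := by
    have : Nat.sub blockMask 1 = 2 ^ 256 - 2 := by decide +kernel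
    rw [carryMask, this]
  set H := X &&& F * ones with hH
  have hbit : ∀ z i, z < 16 → i < 256 →
      H.testBit (256 * z + i) = (X.testBit (256 * z + i) && F.testBit i) := by
    intro z i hz hi
    rw [hH, Nat.testBit_and, ones, mul_ones, testBit_blocks hFF hz hi]
  have hHlt : H < 2 ^ (256 * 16) := by
    refine lt_of_le_of_lt Nat.and_le_right ?_
    rw [ones, mul_ones]
    exact blocks_lt 16 hFF
  have heven : ∀ z, z ≤ 16 → H / 2 ^ (256 * z) % 2 = 0 := by
    intro z hz
    have : H.testBit (256 * z) = false := by
      rcases Nat.lt_or_ge z 16 with h | h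
      · have := hbit z 0 h (by norm_num)
        rw [Nat.add_zero] at this
        rw [this, hF0, Bool.and_false]
      · exact Nat.testBit_lt_two_pow (hHlt.trans_le (Nat.pow_le_pow_right (by norm_num) (by omega)))
    rw [Nat.testBit_eq_decide_div_mod_eq, decide_eq_false_iff_not] at this
    omega
  have hc := carry hy heven
  rw [hfree, Nat.testBit_xor, Nat.testBit_and, testBit_ones hy, Nat.testBit_shiftRight, hmask,
    show 256 + 256 * y = 256 * (y + 1) by ring, hc]
  simp only [ne_eq, decide_not, Bool.and_true, Bool.xor_true, Bool.not_not, decide_eq_true_eq]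
  constructor
  · intro h i hi hX
    have h1 : (H / 2 ^ (256 * y) % 2 ^ 256).testBit i = false := by rw [h, Nat.zero_testBit]
    rw [Nat.testBit_mod_two_pow, Nat.testBit_div_two_pow, add_comm, hbit y i hy hi, hX] at h1
    simpa [hi] using h1
  · intro h
    apply Nat.eq_of_testBit_eq
    intro i
    rw [Nat.testBit_mod_two_pow, Nat.testBit_div_two_pow, Nat.zero_testBit, add_comm]
    by_cases hi : i < 256
    · rw [hbit y i hy hi]
      have := h i hi
      cases hX : X.testBit (256 * y + i) <;> simp_all
    · simp [hi]

/-! ### Branching over the sixteen values -/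

theorem rec_eq_ite (r c n : ℕ) : Nat.rec (motive := fun _ => ℕ) r (fun _ _ => c) n =
    if n = 0 then r else c := by
  cases n <;> simp

theorem and_point {C y : ℕ} : C &&& point y = 0 ↔ C.testBit (256 * y) = false := by
  have hp : point y = 2 ^ (256 * y) := by
    change 1 <<< (256 * y) = _
    rw [Nat.shiftLeft_eq, one_mul]
  rw [hp, Nat.and_two_pow]
  cases C.testBit (256 * y) <;> simp

theorem pick_eq (C : ℕ) (c : ℕ → ℕ) (y r : ℕ) :
    pick C c y r = (if C.testBit (256 * y) then c y else 0) + r := by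
  rw [pick, rec_eq_ite]
  change (if C &&& point y = 0 then r else c y + r) = _
  simp only [and_point]
  cases C.testBit (256 * y) <;> simp

theorem testBit_points {g i : ℕ} (hg : i < 4) :
    (points g).testBit (256 * (4 * g + i)) = true := by
  change (blocks (fun _ => 1) 4 <<< (1024 * g)).testBit _ = _
  rw [Nat.testBit_shiftLeft, show 256 * (4 * g + i) - 1024 * g = 256 * i + 0 by omega,
    testBit_blocks (fun _ _ => by norm_num) hg (by norm_num)]
  simp
  omega

theorem pickFour_eq (C : ℕ) (c : ℕ → ℕ) (g r : ℕ) :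
    pickFour C c g (4 * g) (4 * g + 1) (4 * g + 2) (4 * g + 3) r =
      (∑ i ∈ Finset.range 4, if C.testBit (256 * (4 * g + i)) then c (4 * g + i) else 0) + r := by
  rw [pickFour, rec_eq_ite]
  split
  · next h =>
    have h0 : ∀ i ∈ Finset.range 4,
        (if C.testBit (256 * (4 * g + i)) then c (4 * g + i) else 0) = 0 := by
      intro i hi
      have h2 : (C &&& points g).testBit (256 * (4 * g + i)) = false := by
        rw [show C &&& points g = 0 from h, Nat.zero_testBit]
      rw [Nat.testBit_and, testBit_points (Finset.mem_range.mp hi), Bool.and_true] at h2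
      simp [h2]
    rw [Finset.sum_eq_zero h0, zero_add]
  · simp only [pick_eq, Finset.sum_range_succ, Finset.sum_range_zero]
    simp only [Nat.add_zero]
    ring

theorem pickAll_eq (c : ℕ → ℕ) (C : ℕ) :
    pickAll c C = ∑ y ∈ Finset.range 16, if C.testBit (256 * y) then c y else 0 := by
  rw [pickAll, rec_eq_ite]
  split
  · next h => simp [h]
  · have h0 := pickFour_eq C c 0
    have h1 := pickFour_eq C c 1
    have h2 := pickFour_eq C c 2
    have h3 := pickFour_eq C c 3
    simp only [Nat.mul_zero, Nat.zero_add, Nat.mul_one, Nat.reduceMul, Nat.reduceAdd] at h0 h1 h2 h3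
    rw [h0, h1, h2, h3]
    simp only [Finset.sum_range_succ, Finset.sum_range_zero]
    ring

/-! ### Translation of the blocks by swaps -/

theorem testBit_swapMask {j i : ℕ} (hj : j = 4 ∨ j = 5 ∨ j = 6 ∨ j = 7) (hi : i < 4096) :
    (swapMask (2 ^ j)).testBit i = !i.testBit j := by
  have h : ∀ j ∈ [4, 5, 6, 7], ∀ y : Fin 64, ∀ z : Fin 64,
      (swapMask (2 ^ j)).testBit (64 * y + z) = !(64 * y + z : ℕ).testBit j := by
    decide +kernel
  have := h j (by simpa using hj) ⟨i / 64, by omega⟩ ⟨i % 64, by omega⟩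
  simpa only [Nat.div_add_mod] using this

theorem xor_two_pow_eq {j i : ℕ} (hj : j = 4 ∨ j = 5 ∨ j = 6 ∨ j = 7) (hi : i < 4096) :
    if i.testBit j then i = (i ^^^ 2 ^ j) + 2 ^ j else i ^^^ 2 ^ j = i + 2 ^ j := by
  have h : ∀ j ∈ [4, 5, 6, 7], ∀ y : Fin 64, ∀ z : Fin 64,
      if (64 * y + z : ℕ).testBit j
      then (64 * y + z : ℕ) = ((64 * y + z : ℕ) ^^^ 2 ^ j) + 2 ^ j
      else (64 * y + z : ℕ) ^^^ 2 ^ j = (64 * y + z : ℕ) + 2 ^ j := by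
    decide +kernel
  have := h j (by simpa using hj) ⟨i / 64, by omega⟩ ⟨i % 64, by omega⟩
  simpa only [Nat.div_add_mod] using this

theorem xor_lt {i a n : ℕ} (hi : i < 2 ^ n) (ha : a < 2 ^ n) : i ^^^ a < 2 ^ n :=
  Nat.xor_lt_two_pow hi ha

theorem testBit_swap {j i Z : ℕ} (hj : j = 4 ∨ j = 5 ∨ j = 6 ∨ j = 7) (hi : i < 4096) :
    (swap (2 ^ j) Z).testBit i = Z.testBit (i ^^^ 2 ^ j) := by
  have hs : swap (2 ^ j) Z =
    (Z >>> 2 ^ j &&& swapMask (2 ^ j)) ||| (Z &&& swapMask (2 ^ j)) <<< 2 ^ j := rfl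
  have hlt : i ^^^ 2 ^ j < 2 ^ 12 := by
    apply xor_lt hi
    rcases hj with rfl | rfl | rfl | rfl <;> norm_num
  have h2 := xor_two_pow_eq hj hi
  have h3 : (i ^^^ 2 ^ j).testBit j = !i.testBit j := by
    rw [Nat.testBit_xor, Nat.testBit_two_pow_self, Bool.xor_true]
  rw [hs, Nat.testBit_or, Nat.testBit_and, Nat.testBit_shiftRight, Nat.testBit_shiftLeft,
    Nat.testBit_and, testBit_swapMask hj hi]
  cases hb : i.testBit j
  · simp only [hb, Bool.false_eq_true, if_false] at h2
    rw [h2, add_comm i]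
    by_cases hle : 2 ^ j ≤ i
    · have h4 := xor_two_pow_eq hj (i := i - 2 ^ j) (lt_of_le_of_lt (Nat.sub_le _ _) hi)
      -- What the left shift brings to `i` comes from `i - 2 ^ j`, where digit `j` is one, so the
      -- mask has removed it.
      have h5 : (i - 2 ^ j).testBit j = true := by
        by_contra h5
        rw [if_neg h5, Nat.sub_add_cancel hle] at h4
        rw [← h4, Nat.testBit_xor, Nat.testBit_two_pow_self] at hb
        simp at hb
        exact h5 hb
      rw [testBit_swapMask hj (lt_of_le_of_lt (Nat.sub_le _ _) hi), h5]
      simp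
    · simp [hle]
  · rw [hb, if_pos rfl] at h2
    have h4 : i - 2 ^ j = i ^^^ 2 ^ j := by omega
    rw [h4, testBit_swapMask hj hlt, h3, hb]
    simp
    omega

/-- `t` translates blocks by `a`. -/
def IsTranslation (t : ℕ → ℕ) (a : ℕ) : Prop :=
  ∀ Z i, i < 4096 → (t Z).testBit i = Z.testBit (i ^^^ a)

theorem isTranslation_swap {j : ℕ} (hj : j = 4 ∨ j = 5 ∨ j = 6 ∨ j = 7) :
    IsTranslation (swap (2 ^ j)) (2 ^ j) := fun _ _ hi => testBit_swap hj hi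

theorem IsTranslation.comp {t t' : ℕ → ℕ} {a b : ℕ} (ht : IsTranslation t a)
    (ht' : IsTranslation t' b) (ha : a < 4096) : IsTranslation (fun Z => t (t' Z)) (a ^^^ b) := by
  intro Z i hi
  have : i ^^^ a < 2 ^ 12 := xor_lt hi ha
  rw [ht _ _ hi, ht' _ _ this, Nat.xor_assoc]

theorem two_pow_mul_add_xor {n y i a : ℕ} (hi : i < 2 ^ n) (ha : a < 2 ^ n) :
    (2 ^ n * y + i) ^^^ a = 2 ^ n * y + (i ^^^ a) := by
  apply Nat.eq_of_testBit_eq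
  intro j
  rw [Nat.testBit_xor, Nat.testBit_two_pow_mul_add _ hi,
    Nat.testBit_two_pow_mul_add _ (xor_lt hi ha), Nat.testBit_xor]
  split
  · rfl
  · next hj =>
    rw [Nat.testBit_lt_two_pow (x := a), Bool.xor_false]
    exact lt_of_lt_of_le ha (Nat.pow_le_pow_right (by norm_num) (Nat.le_of_not_lt hj))

/-! ### Differences and admissible partial graphs -/

/-- The number of unordered pairs of entries of `G` with difference `i`. -/
def npairs : List ℕ → ℕ → ℕ
  | [], _ => 0
  | w :: G, i => npairs G i + G.count (w ^^^ i)

theorem npairs_zero {G : List ℕ} (hG : G.Nodup) : npairs G 0 = 0 := by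
  induction G with
  | nil => rfl
  | cons w G ih =>
    rw [List.nodup_cons] at hG
    rw [npairs, ih hG.2, Nat.xor_zero, List.count_eq_zero_of_not_mem hG.1]

/-- No difference occurs more than twice, and no forbidden difference occurs. -/
def Admissible (G : List ℕ) : Prop :=
  ∀ i, i < 256 → npairs G i ≤ 2 ∧ (forbidden.testBit i = true → npairs G i = 0)

theorem Admissible.of_cons {w : ℕ} {G : List ℕ} (h : Admissible (w :: G)) : Admissible G := by
  intro i hi
  have := h i hi
  rw [npairs] at this
  exact ⟨by omega, fun hb => by have := this.2 hb; omega⟩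

/-- A new code adds at most one pair to each difference, and only to those `i` with `w ^^^ i` in
`G`. The excluded `i` are exactly those recorded by `F` in `Describes`. -/
theorem admissible_cons {w : ℕ} {G : List ℕ} (hG : Admissible G) (hn : G.Nodup) :
    Admissible (w :: G) ↔ ∀ i, i < 256 → w ^^^ i ∈ G →
      ¬ (forbidden.testBit i = true ∨ 2 ≤ npairs G i) := by
  refine forall₂_congr fun i hi => ?_
  have h := hG i hi
  rw [npairs]
  by_cases hm : w ^^^ i ∈ G
  · rw [List.count_eq_one_of_mem hn hm]
    simp only [hm, forall_const, not_or]
    constructor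
    · rintro ⟨h1, h2⟩
      exact ⟨fun hb => by have := h2 hb; omega, by omega⟩
    · rintro ⟨h1, h2⟩
      exact ⟨by omega, fun hb => absurd hb h1⟩
  · rw [List.count_eq_zero_of_not_mem hm]
    simp only [hm, false_imp_iff, iff_true]
    exact h

/-- The numbers `F`, `S`, `Z` describe the partial function `G`. -/
structure Describes (F S Z : ℕ) (G : List ℕ) : Prop where
  nodup : (G.map (· / 16)).Nodup
  lt : ∀ w ∈ G, w < 256
  F_lt : F < 2 ^ 256
  testBit_F : ∀ i, i < 256 → (F.testBit i = true ↔ forbidden.testBit i = true ∨ 2 ≤ npairs G i)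
  testBit_S : ∀ i, i < 256 → (S.testBit i = true ↔ 1 ≤ npairs G i)
  testBit_Z : ∀ y i, y < 16 → i < 256 → (Z.testBit (256 * y + i) = true ↔ y ^^^ i ∈ G)

theorem describes_nil : Describes forbidden 0 0 [] where
  nodup := List.nodup_nil
  lt := by simp
  F_lt := by decide +kernel
  testBit_F := by simp [npairs]
  testBit_S := by simp [npairs]
  testBit_Z := by simp

theorem blocks_mul (h : ℕ → ℕ) (c n : ℕ) : blocks h n * c = blocks (fun y => h y * c) n := by
  induction n with
  | zero => exact Nat.zero_mul c
  | succ n ih => rw [blocks_succ, blocks_succ, ← ih]; ring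

theorem xor_lt_sixteen {y z : ℕ} (hy : y < 16) (hz : z < 16) : y ^^^ z < 16 :=
  xor_lt (n := 4) hy hz

theorem testBit_translates {x y z i : ℕ} (hx : x < 16) (hy : y < 16) (hz : z < 16) (hi : i < 256) :
    (Nat.shiftLeft (translates y) (16 * x)).testBit (256 * z + i) = true ↔
      z ^^^ i = 16 * x + y := by
  have h : Nat.shiftLeft (translates y) (16 * x) = blocks (fun z => 2 ^ (16 * x + (y ^^^ z))) 16 := by
    change translates y <<< (16 * x) = _
    rw [Nat.shiftLeft_eq, translates, blocks_mul]
    congr 1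
    funext z
    change 1 <<< (z ^^^ y) * _ = _
    rw [Nat.shiftLeft_eq, one_mul, Nat.xor_comm, pow_add, mul_comm]
  rw [h, testBit_blocks (h := fun z => 2 ^ (16 * x + (y ^^^ z))) _ hz hi, Nat.testBit_two_pow,
    decide_eq_true_eq]
  · have := two_pow_mul_add_xor (n := 4) (y := x) hy hz
    norm_num at this
    rw [← this, Nat.xor_comm z]
    constructor
    · rintro rfl
      rw [Nat.xor_xor_cancel_right]
    · intro h
      rw [← h, Nat.xor_xor_cancel_right]
  · intro z hz
    have := xor_lt_sixteen hy hz
    exact Nat.pow_lt_pow_right (by norm_num) (by omega)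

theorem Describes.cons {F S Z P K w : ℕ} {G : List ℕ} (h : Describes F S Z G)
    (hw : w < 256) (hwG : w / 16 ∉ G.map (· / 16))
    (hP : ∀ i, i < 256 → (P.testBit i = true ↔ w ^^^ i ∈ G))
    (hK : ∀ y i, y < 16 → i < 256 → (K.testBit (256 * y + i) = true ↔ y ^^^ i = w))
    (hP' : P < 2 ^ 256) :
    Describes (F ||| (P &&& S)) (S ||| P) (Z ||| K) (w :: G) where
  nodup := by rw [List.map_cons, List.nodup_cons]; exact ⟨hwG, h.nodup⟩
  lt := by
    intro v hv
    rcases List.mem_cons.mp hv with rfl | hv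
    · exact hw
    · exact h.lt v hv
  F_lt := Nat.or_lt_two_pow h.F_lt (lt_of_le_of_lt Nat.and_le_left hP')
  testBit_F := by
    intro i hi
    have hn : G.Nodup := h.nodup.of_map _
    rw [Nat.testBit_or, Nat.testBit_and, Bool.or_eq_true, Bool.and_eq_true, hP i hi,
      h.testBit_F i hi, h.testBit_S i hi, npairs]
    by_cases hm : w ^^^ i ∈ G
    · rw [List.count_eq_one_of_mem hn hm]
      simp only [hm, true_and, or_assoc]
      have : (2 ≤ npairs G i ∨ 1 ≤ npairs G i) ↔ 2 ≤ npairs G i + 1 := by omega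
      rw [this]
    · rw [List.count_eq_zero_of_not_mem hm]
      simp [hm]
  testBit_S := by
    intro i hi
    have hn : G.Nodup := h.nodup.of_map _
    rw [Nat.testBit_or, Bool.or_eq_true, hP i hi, h.testBit_S i hi, npairs]
    by_cases hm : w ^^^ i ∈ G
    · rw [List.count_eq_one_of_mem hn hm]
      simp [hm]
    · rw [List.count_eq_zero_of_not_mem hm]
      simp [hm]
  testBit_Z := by
    intro y i hy hi
    rw [Nat.testBit_or, Bool.or_eq_true, h.testBit_Z y i hy hi, hK y i hy hi, List.mem_cons]
    tauto

/-! ### Functions and their codes -/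

/-- The vector with code `n`. -/
def vec (n : ℕ) : Vec 4 := fun i => if n.testBit i then 1 else 0

/-- The code of a vector. -/
def code (v : Vec 4) : ℕ := (v 0).val + 2 * (v 1).val + 4 * (v 2).val + 8 * (v 3).val

theorem code_lt (v : Vec 4) : code v < 16 := by
  have h0 := ZMod.val_lt (v 0)
  have h1 := ZMod.val_lt (v 1)
  have h2 := ZMod.val_lt (v 2)
  have h3 := ZMod.val_lt (v 3)
  rw [code]
  omega

theorem vec_code (v : Vec 4) : vec (code v) = v := by
  revert v
  decide +kernel

theorem code_vec {n : ℕ} (hn : n < 16) : code (vec n) = n := by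
  have h : ∀ n : Fin 16, code (vec n) = n := by decide +kernel
  exact h ⟨n, hn⟩

theorem vec_inj {a b : ℕ} (ha : a < 16) (hb : b < 16) : vec a = vec b ↔ a = b :=
  ⟨fun h => by rw [← code_vec ha, h, code_vec hb], fun h => by rw [h]⟩

theorem code_inj {a b : Vec 4} : code a = code b ↔ a = b :=
  ⟨fun h => by rw [← vec_code a, h, vec_code], fun h => by rw [h]⟩

theorem vec_xor (a b : ℕ) : vec (a ^^^ b) = vec a + vec b := by
  funext i
  simp only [vec, Nat.testBit_xor, Pi.add_apply]
  cases a.testBit i <;> cases b.testBit i <;> decide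

theorem vec_zero : vec 0 = 0 := by
  funext i
  simp [vec]

theorem code_add (a b : Vec 4) : code (a + b) = code a ^^^ code b := by
  have h : code a ^^^ code b < 16 := xor_lt_sixteen (code_lt a) (code_lt b)
  rw [← code_vec h, vec_xor, vec_code, vec_code]

theorem add_self_vec (a : Vec 4) : a + a = 0 := CharTwo.add_self_eq_zero a

/-- The function `f` extends the partial function with graph `G`. -/
def Agrees (f : Vec 4 → Vec 4) (G : List ℕ) : Prop :=
  ∀ w ∈ G, f (vec (w / 16)) = vec (w % 16)

instance (f : Vec 4 → Vec 4) (G : List ℕ) : Decidable (Agrees f G) :=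
  inferInstanceAs (Decidable (∀ w ∈ G, _))

theorem agrees_cons {f : Vec 4 → Vec 4} {G : List ℕ} {x y : ℕ} (hy : y < 16) :
    Agrees f ((16 * x + y) :: G) ↔ code (f (vec x)) = y ∧ Agrees f G := by
  rw [Agrees, List.forall_mem_cons, show (16 * x + y) / 16 = x by omega,
    show (16 * x + y) % 16 = y by omega, ← vec_inj (code_lt _) hy, vec_code]
  rfl

/-- Every unordered pair is seen from both of its ends; as `i ≠ 0`, no entry is its own partner. -/
theorem sum_count {G : List ℕ} {i : ℕ} (hi : i ≠ 0) :
    (G.map fun w => G.count (w ^^^ i)).sum = 2 * npairs G i := by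
  induction G with
  | nil => rfl
  | cons w G ih =>
    have h1 : (w == w ^^^ i) = false := by
      rw [beq_eq_false_iff_ne]
      intro h
      apply hi
      rw [← Nat.xor_xor_cancel_left w i, ← h, Nat.xor_self]
    have h2 : ∀ L : List ℕ, (L.map fun v => if w == v ^^^ i then 1 else 0).sum =
        L.count (w ^^^ i) := by
      intro L
      induction L with
      | nil => rfl
      | cons v L ih =>
        rw [List.map_cons, List.sum_cons, ih, List.count_cons, add_comm]
        congr 1
        have : (w == v ^^^ i) = (v == w ^^^ i) := by
          rw [Bool.eq_iff_iff, beq_iff_eq, beq_iff_eq]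
          constructor
          · rintro rfl
            rw [Nat.xor_xor_cancel_right]
          · rintro rfl
            rw [Nat.xor_xor_cancel_right]
        rw [this]
    rw [List.map_cons, List.sum_cons]
    simp only [List.count_cons, h1, List.sum_map_add, ih, h2, npairs]
    simp only [Bool.false_eq_true, if_false]
    ring

theorem two_mul_npairs {G : List ℕ} (hG : G.Nodup) {i : ℕ} (hi : i ≠ 0) :
    2 * npairs G i = (G.toFinset.filter fun w => w ^^^ i ∈ G).card := by
  rw [← sum_count hi, ← List.sum_toFinset _ hG, Finset.card_filter]
  refine Finset.sum_congr rfl fun w _ => ?_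
  split
  · next h => exact List.count_eq_one_of_mem hG h
  · next h => exact List.count_eq_zero_of_not_mem h

theorem xor_div_sixteen (a b : ℕ) : (a ^^^ b) / 16 = a / 16 ^^^ b / 16 :=
  Nat.xor_div_two_pow (n := 4)

theorem xor_mod_sixteen (a b : ℕ) : (a ^^^ b) % 16 = a % 16 ^^^ b % 16 :=
  Nat.xor_mod_two_pow (n := 4)

/-- The points at which the derivative of `f` in direction `u` takes the value `v`. -/
abbrev solutions (f : Vec 4 → Vec 4) (u v : Vec 4) : Finset (Vec 4) :=
  Finset.univ.filter fun x => derivative f u x = v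

theorem pairs_subset {f : Vec 4 → Vec 4} {G : List ℕ} (hf : Agrees f G) (i : ℕ) :
    (G.toFinset.filter fun w => w ^^^ i ∈ G).image (fun w => vec (w / 16)) ⊆
      solutions f (vec (i / 16)) (vec (i % 16)) := by
  intro x hx
  obtain ⟨w, hw, rfl⟩ := Finset.mem_image.mp hx
  rw [Finset.mem_filter, List.mem_toFinset] at hw
  rw [Finset.mem_filter]
  refine ⟨Finset.mem_univ _, ?_⟩
  rw [derivative, ← vec_xor, ← xor_div_sixteen, hf _ hw.1, hf _ hw.2, xor_mod_sixteen, vec_xor,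
    add_right_comm, add_self_vec, zero_add]

theorem code_injOn {G : List ℕ} (hG : (G.map (· / 16)).Nodup) (hlt : ∀ w ∈ G, w < 256) {a b : ℕ}
    (ha : a ∈ G) (hb : b ∈ G) (h : vec (a / 16) = vec (b / 16)) : a = b := by
  have h1 := hlt a ha
  have h2 := hlt b hb
  rw [vec_inj (by omega) (by omega)] at h
  exact List.inj_on_of_nodup_map hG ha hb h

/-- Graph points with difference (u, v) are (x, f x) and (x + u, f x + v), so both x and x + u solve
the derivative equation. For a complete graph every solution arises in this way (`card_solutions`).
-/
theorem two_mul_npairs_le {f : Vec 4 → Vec 4} {G : List ℕ} (hG : (G.map (· / 16)).Nodup)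
    (hlt : ∀ w ∈ G, w < 256) (hf : Agrees f G) {i : ℕ} (hi : i ≠ 0) :
    2 * npairs G i ≤ (solutions f (vec (i / 16)) (vec (i % 16))).card := by
  rw [two_mul_npairs (hG.of_map _) hi]
  refine le_trans (le_of_eq (Finset.card_image_of_injOn ?_).symm)
    (Finset.card_le_card (pairs_subset hf i))
  intro a ha b hb h
  simp only [Finset.coe_filter, List.mem_toFinset, Set.mem_ofPred_eq] at ha hb
  exact code_injOn hG hlt ha.1 hb.1 h

theorem card_solutions {f : Vec 4 → Vec 4} {G : List ℕ} (hG : (G.map (· / 16)).Nodup)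
    (hlt : ∀ w ∈ G, w < 256) (hf : Agrees f G) (hall : ∀ x, x < 16 → x ∈ G.map (· / 16)) {i : ℕ}
    (hi : i ≠ 0) (hi' : i < 256) :
    (solutions f (vec (i / 16)) (vec (i % 16))).card = 2 * npairs G i := by
  refine le_antisymm ?_ (two_mul_npairs_le hG hlt hf hi)
  rw [two_mul_npairs (hG.of_map _) hi]
  refine le_trans (Finset.card_le_card ?_) (Finset.card_image_le (f := fun w => vec (w / 16)))
  intro x hx
  rw [Finset.mem_filter, derivative] at hx
  obtain ⟨a, ha, hxa⟩ := List.mem_map.mp (hall _ (code_lt x))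
  obtain ⟨b, hb, hxb⟩ := List.mem_map.mp (hall _ (code_lt (x + vec (i / 16))))
  have ha' := hf a ha
  have hb' := hf b hb
  rw [hxa, vec_code] at ha'
  rw [hxb, vec_code] at hb'
  rw [ha', hb'] at hx
  rw [Finset.mem_image]
  refine ⟨a, ?_, by rw [hxa, vec_code]⟩
  rw [Finset.mem_filter, List.mem_toFinset]
  refine ⟨ha, ?_⟩
  have : a ^^^ i = b := by
    have h1 : (a ^^^ i) / 16 = b / 16 := by
      rw [xor_div_sixteen, hxa, hxb, code_add, code_vec (by omega)]
    have h2 : (a ^^^ i) % 16 = b % 16 := by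
      rw [← vec_inj (by omega) (by omega), xor_mod_sixteen, vec_xor, ← hx.2, add_left_comm,
        add_self_vec, add_zero]
    omega
  rwa [this]

theorem forbidden_iff : ∀ u v : Fin 16, u ≠ 0 → (forbidden.testBit (16 * u + v) = true ↔
    v = 0 ∨ hammingNorm (vec u) = 1 ∧ hammingNorm (vec v) = 1) := by
  decide +kernel

theorem diff₁_eq_zero_iff {f : Vec 4 → Vec 4} : Diff₁ f = 0 ↔
    ∀ u v : Vec 4, hammingNorm u = 1 → hammingNorm v = 1 → (solutions f u v).card = 0 := by
  rw [Diff₁, ← bot_eq_zero', Finset.sup_eq_bot_iff]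
  simp only [Finset.mem_filter, Finset.mem_univ, true_and, Prod.forall]
  exact ⟨fun h u v hu hv => h u v ⟨hu, hv⟩, fun h u v huv => h u v huv.1 huv.2⟩

theorem solutions_zero {f : Vec 4 → Vec 4} (hf : Function.Injective f) {u : Vec 4} (hu : u ≠ 0) :
    solutions f u 0 = ∅ := by
  rw [Finset.filter_eq_empty_iff]
  intro x _ h
  rw [derivative, CharTwo.add_eq_zero] at h
  exact hu (add_eq_left.mp (hf h))

/-- This is what makes the pruning lossless. -/
theorem IsStrong.admissible {f : Vec 4 → Vec 4} (h : IsStrong f) {G : List ℕ}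
    (hG : (G.map (· / 16)).Nodup) (hlt : ∀ w ∈ G, w < 256) (hf : Agrees f G) : Admissible G := by
  intro i hi
  rcases Nat.eq_zero_or_pos i with rfl | hpos
  · simp [npairs_zero (hG.of_map _)]
  have hle := two_mul_npairs_le hG hlt hf hpos.ne'
  -- `forbidden_iff` does not cover the row u = 0. There no pair occurs at all, because distinct
  -- codes in `G` have distinct positions.
  by_cases hu : i / 16 = 0
  · have : npairs G i = 0 := by
      have h1 := two_mul_npairs (hG.of_map _) hpos.ne'
      rw [Finset.card_eq_zero.mpr] at h1
      · omega
      rw [Finset.filter_eq_empty_iff]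
      intro w hw hw'
      rw [List.mem_toFinset] at hw
      have h2 := List.inj_on_of_nodup_map hG hw hw' (by rw [xor_div_sixteen, hu, Nat.xor_zero])
      have := Nat.xor_xor_cancel_left w i
      rw [← h2, Nat.xor_self] at this
      omega
    simp [this]
  have hu' : vec (i / 16) ≠ 0 := by
    rw [← vec_zero, Ne, vec_inj (by omega) (by norm_num)]
    exact hu
  refine ⟨?_, fun hb => ?_⟩
  · have : (solutions f _ _).card ≤ 4 := h.differentiallyUniform _ hu' (vec (i % 16))
    omega
  · have h1 := forbidden_iff ⟨i / 16, by omega⟩ ⟨i % 16, by omega⟩ (by simpa [Fin.ext_iff] using hu)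
    simp only [Nat.div_add_mod] at h1
    have h2 : (solutions f (vec (i / 16)) (vec (i % 16))).card = 0 := by
      rcases h1.mp hb with h2 | h2
      · have h3 : i % 16 = 0 := by simpa [Fin.ext_iff] using h2
        rw [h3, vec_zero, solutions_zero h.bijective.injective hu', Finset.card_empty]
      · exact diff₁_eq_zero_iff.mp h.diff₁_eq _ _ h2.1 h2.2
    omega

/-! ### Sums over extensions and the induction over positions -/

/-- The sum of `Φ` over the extensions of `G`. -/
noncomputable def total (Φ : (Vec 4 → Vec 4) → ℕ) (G : List ℕ) : ℕ :=
  ∑ f with Agrees f G, Φ f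

theorem total_eq_sum (Φ : (Vec 4 → Vec 4) → ℕ) (G : List ℕ) (x : ℕ) :
    total Φ G = ∑ y ∈ Finset.range 16, total Φ ((16 * x + y) :: G) := by
  rw [total, ← Finset.sum_fiberwise_of_maps_to (t := Finset.range 16)
    (g := fun f : Vec 4 → Vec 4 => code (f (vec x))) fun f _ => Finset.mem_range.mpr (code_lt _)]
  refine Finset.sum_congr rfl fun y hy => ?_
  rw [total, Finset.filter_filter]
  refine Finset.sum_congr (Finset.filter_congr fun f _ => ?_) fun _ _ => rfl
  rw [agrees_cons (Finset.mem_range.mp hy), and_comm]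

/-- `Φ` vanishes at the functions that are not strong. -/
def Restricts (Φ : (Vec 4 → Vec 4) → ℕ) : Prop := ∀ f, ¬ IsStrong f → Φ f = 0

theorem total_eq_zero {Φ : (Vec 4 → Vec 4) → ℕ} (hΦ : Restricts Φ) {G : List ℕ}
    (hG : (G.map (· / 16)).Nodup) (hlt : ∀ w ∈ G, w < 256) (h : ¬ Admissible G) :
    total Φ G = 0 := by
  refine Finset.sum_eq_zero fun f hf => hΦ f fun hs => h ?_
  exact hs.admissible hG hlt (Finset.mem_filter.mp hf).2

/-- `k` computes the sums of `Φ` from partial functions with the list of positions `ps` that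
map zero to zero. -/
def Computes (Φ : (Vec 4 → Vec 4) → ℕ) (k : Search) (ps : List ℕ) : Prop :=
  ∀ F S Z G, Describes F S Z G → Admissible G → 0 ∈ G → G.map (· / 16) = ps →
    k F S Z G = total Φ G

theorem testBit_block {X y i : ℕ} (hi : i < 256) :
    (Nat.land (Nat.shiftRight X (Nat.mul 256 y)) blockMask).testBit i = X.testBit (256 * y + i) := by
  change (X >>> (256 * y) &&& blockMask).testBit i = _
  rw [blockMask_eq, Nat.testBit_and, Nat.testBit_shiftRight, Nat.testBit_two_pow_sub_one]
  simp [hi]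

/-- The sum splits according to the value `y` at `x`. Block `y` of `t Z` lists the differences
between `16 * x + y` and `G`, so the bit of `free` expresses admissibility of the extension. A
skipped branch has no strong extension and contributes 0. -/
theorem Computes.node {Φ : (Vec 4 → Vec 4) → ℕ} (hΦ : Restricts Φ) {k : Search} {x : ℕ}
    {ps : List ℕ} {t : ℕ → ℕ} (hk : Computes Φ k (x :: ps)) (hx : x < 16) (hps : x ∉ ps)
    (ht : IsTranslation t (16 * x)) : Computes Φ (node k t (16 * x)) ps := by
  intro F S Z G hD hA h0 hG
  have hn : G.Nodup := hD.nodup.of_map _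
  rw [SBox.node, branch, pickAll_eq, total_eq_sum Φ G x]
  refine Finset.sum_congr rfl fun y hy => ?_
  rw [Finset.mem_range] at hy
  have hw : 16 * x + y < 256 := by omega
  have hX : ∀ i, i < 256 → ((t Z).testBit (256 * y + i) = true ↔ (16 * x + y) ^^^ i ∈ G) := by
    intro i hi
    have h1 := two_pow_mul_add_xor (n := 8) (y := y) hi (show 16 * x < 2 ^ 8 by omega)
    norm_num at h1
    have h2 : i ^^^ 16 * x < 256 := xor_lt (n := 8) hi (by omega)
    rw [ht _ _ (by omega), h1, hD.testBit_Z y _ hy h2]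
    have h3 := two_pow_mul_add_xor (n := 4) (y := x) (i := 0) (by norm_num) hy
    norm_num at h3
    rw [← h3, ← Nat.xor_assoc, Nat.xor_comm, Nat.xor_assoc]
  have hF0 : F.testBit 0 = false := by
    rw [← Bool.not_eq_true, hD.testBit_F 0 (by norm_num), npairs_zero hn]
    decide +kernel
  have hC := testBit_free (X := t Z) hD.F_lt hF0 hy
  have hA' : (free (t Z) F).testBit (256 * y) = true ↔ Admissible ((16 * x + y) :: G) := by
    rw [hC, admissible_cons hA hn]
    refine forall₂_congr fun i hi => ?_
    rw [hX i hi, ← hD.testBit_F i hi, Bool.not_eq_true]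
  have hpos : (16 * x + y) / 16 ∉ G.map (· / 16) := by
    rw [hG, show (16 * x + y) / 16 = x by omega]
    exact hps
  have hD' := hD.cons (P := Nat.land (Nat.shiftRight (t Z) (Nat.mul 256 y)) blockMask)
    (K := Nat.shiftLeft (translates y) (16 * x)) hw hpos
    (fun i hi => by rw [testBit_block hi, hX i hi])
    (fun z i hz hi => testBit_translates hx hy hz hi)
    (lt_of_le_of_lt Nat.and_le_right (by rw [blockMask_eq]; norm_num))
  split
  · next h =>
    refine hk _ _ _ _ hD' (hA'.mp h) (List.mem_cons_of_mem _ h0) ?_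
    rw [List.map_cons, hG]
    congr 1
    change (16 * x + y) / 16 = x
    omega
  · next h => exact (total_eq_zero hΦ hD'.nodup hD'.lt fun h' => h (hA'.mpr h')).symm

theorem Computes.begin {Φ : (Vec 4 → Vec 4) → ℕ} (hΦ : Restricts Φ) {k : Search} {l : List ℕ} :
    ∀ {F S Z : ℕ} {G : List ℕ}, Computes Φ k ((l.reverse ++ G).map (· / 16)) →
    Describes F S Z G → Admissible G → ((l.reverse ++ G).map (· / 16)).Nodup →
    (∀ w ∈ l, w < 256) → 0 ∈ l.reverse ++ G → begin k l F S Z G = total Φ (l.reverse ++ G) := by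
  induction l with
  | nil =>
    intro F S Z G hk hD hA _ _ h0
    exact hk F S Z G hD hA h0 rfl
  | cons w l ih =>
    intro F S Z G hk hD hA hnd hlt h0
    have hn : G.Nodup := hD.nodup.of_map _
    rw [List.reverse_cons, List.append_assoc, List.singleton_append] at hk hnd h0 ⊢
    have hw : w < 256 := hlt w List.mem_cons_self
    have hpos : w / 16 ∉ G.map (· / 16) := by
      rw [List.map_append, List.nodup_append, List.map_cons, List.nodup_cons] at hnd
      exact hnd.2.1.1
    have hP : ∀ L : List ℕ, (∀ v ∈ L, v < 256) → differences L w < 2 ^ 256 ∧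
        ∀ i, i < 256 → ((differences L w).testBit i = true ↔ w ^^^ i ∈ L) := by
      intro L hL
      induction L with
      | nil =>
        refine ⟨by change 0 < _; norm_num, fun i _ => ?_⟩
        change Nat.testBit 0 i = true ↔ _
        simp
      | cons v L ih =>
        obtain ⟨h1, h2⟩ := ih fun v hv => hL v (List.mem_cons_of_mem _ hv)
        have h3 : differences (v :: L) w = 2 ^ (w ^^^ v) ||| differences L w := by
          change (1 <<< (w ^^^ v)) ||| _ = _
          rw [Nat.shiftLeft_eq, one_mul]
          rfl
        have h4 : w ^^^ v < 256 := xor_lt (n := 8) hw (hL v List.mem_cons_self)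
        refine ⟨?_, fun i hi => ?_⟩
        · rw [h3]
          exact Nat.or_lt_two_pow (Nat.pow_lt_pow_right (by norm_num) h4) h1
        · rw [h3, Nat.testBit_or, Bool.or_eq_true, h2 i hi, Nat.testBit_two_pow, decide_eq_true_eq,
            List.mem_cons]
          refine or_congr_left ⟨?_, ?_⟩
          · rintro rfl
            rw [Nat.xor_xor_cancel_left]
          · rintro rfl
            rw [Nat.xor_xor_cancel_left]
    obtain ⟨hP1, hP2⟩ := hP G hD.lt
    have e1 : Nat.land w 15 = w % 16 := Nat.and_two_pow_sub_one_eq_mod w 4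
    have e2 : Nat.mul 16 (Nat.shiftRight w 4) = 16 * (w / 16) := by
      change 16 * (w >>> 4) = _
      rw [Nat.shiftRight_eq_div_pow]
    have hD' := hD.cons (P := differences G w) (K := Nat.shiftLeft (translates (Nat.land w 15))
      (Nat.mul 16 (Nat.shiftRight w 4))) hw hpos hP2
      (fun z i hz hi => by
        rw [e1, e2, testBit_translates (by omega) (by omega) hz hi, Nat.div_add_mod]) hP1
    have hbeg : SBox.begin k (w :: l) F S Z G = if differences G w &&& F = 0 then
        SBox.begin k l (F ||| (differences G w &&& S)) (S ||| differences G w)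
          (Z ||| Nat.shiftLeft (translates (Nat.land w 15)) (Nat.mul 16 (Nat.shiftRight w 4)))
          (w :: G) else 0 := by
      exact rec_eq_ite _ _ _
    have hA' : differences G w &&& F = 0 ↔ Admissible (w :: G) := by
      rw [admissible_cons hA hn]
      constructor
      · intro h i hi hm hb
        rw [← hP2 i hi] at hm
        rw [← hD.testBit_F i hi] at hb
        have := congrArg (Nat.testBit · i) h
        simp [hm, hb] at this
      · intro h
        apply Nat.eq_of_testBit_eq
        intro i
        rw [Nat.testBit_and, Nat.zero_testBit, Bool.and_eq_false_iff]
        by_cases hi : i < 256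
        · by_cases hm : w ^^^ i ∈ G
          · right
            rw [← Bool.not_eq_true, hD.testBit_F i hi]
            exact h i hi hm
          · left
            rw [← Bool.not_eq_true, hP2 i hi]
            exact hm
        · left
          exact Nat.testBit_lt_two_pow (hP1.trans_le (Nat.pow_le_pow_right (by norm_num) (by omega)))
    rw [hbeg]
    split
    · next h => exact ih hk hD' (hA'.mp h) hnd (fun v hv => hlt v (List.mem_cons_of_mem _ hv)) h0
    · next h =>
      -- The search stops at `w :: G`, while the sum concerns the whole list. Admissibility passes
      -- to sublists, so the whole list is inadmissible too.
      refine (total_eq_zero hΦ hnd ?_ fun h' => h (hA'.mpr ?_)).symm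
      · intro v hv
        rw [List.mem_append, List.mem_reverse, List.mem_cons] at hv
        rcases hv with hv | rfl | hv
        · exact hlt v (List.mem_cons_of_mem _ hv)
        · exact hw
        · exact hD.lt v hv
      · have hsuff : ∀ L : List ℕ, Admissible (L ++ w :: G) → Admissible (w :: G) := by
          intro L
          induction L with
          | nil => exact id
          | cons v L ih => exact fun h => ih h.of_cons
        exact hsuff _ h'

theorem Computes.search {Φ : (Vec 4 → Vec 4) → ℕ} (hΦ : Restricts Φ)
    (h : Computes Φ leaf [15, 14, 13, 12, 11, 10, 9, 7, 6, 5, 3, 8, 4, 2, 1, 0]) :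
    Computes Φ search [8, 4, 2, 1, 0] := by
  have h4 : IsTranslation (swap 16) 16 := isTranslation_swap (j := 4) (by simp)
  have h5 : IsTranslation (swap 32) 32 := isTranslation_swap (j := 5) (by simp)
  have h6 : IsTranslation (swap 64) 64 := isTranslation_swap (j := 6) (by simp)
  have h7 : IsTranslation (swap 128) 128 := isTranslation_swap (j := 7) (by simp)
  have h67 := h6.comp h7 (by norm_num)
  have h57 := h5.comp h7 (by norm_num)
  have h47 := h4.comp h7 (by norm_num)
  have h56 := h5.comp h6 (by norm_num)
  have h567 := h5.comp h67 (by norm_num)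
  replace h := h.node hΦ (by norm_num) (by decide) (h4.comp h567 (by norm_num))
  replace h := h.node hΦ (by norm_num) (by decide) h567
  replace h := h.node hΦ (by norm_num) (by decide) (h4.comp h67 (by norm_num))
  replace h := h.node hΦ (by norm_num) (by decide) h67
  replace h := h.node hΦ (by norm_num) (by decide) (h4.comp h57 (by norm_num))
  replace h := h.node hΦ (by norm_num) (by decide) h57
  replace h := h.node hΦ (by norm_num) (by decide) h47
  replace h := h.node hΦ (by norm_num) (by decide) (h4.comp h56 (by norm_num))
  replace h := h.node hΦ (by norm_num) (by decide) h56
  replace h := h.node hΦ (by norm_num) (by decide) (h4.comp h6 (by norm_num))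
  exact h.node hΦ (by norm_num) (by decide) (h4.comp h5 (by norm_num))

/-! ### The test at the leaves -/

theorem allOf_iff {p : ℕ → Bool} {l : List ℕ} : allOf p l = true ↔ ∀ a ∈ l, p a = true := by
  induction l with
  | nil => simp [allOf]
  | cons a l ih =>
    rw [List.forall_mem_cons, ← ih]
    change Bool.rec false (allOf p l) (p a) = true ↔ _
    cases p a <;> simp

theorem anyOf_iff {p : ℕ → Bool} {l : List ℕ} : anyOf p l = true ↔ ∃ a ∈ l, p a = true := by
  induction l with
  | nil => simp [anyOf]
  | cons a l ih =>
    rw [List.exists_mem_cons_iff, ← ih]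
    change Bool.rec (anyOf p l) true (p a) = true ↔ _
    cases p a <;> simp

theorem countOf_eq (p : ℕ → Bool) (l : List ℕ) : countOf p l = l.countP p := by
  induction l with
  | nil => rfl
  | cons a l ih =>
    rw [List.countP_cons, ← ih]
    have h : countOf p (a :: l) = if p a then countOf p l + 1 else countOf p l := by
      change Bool.rec (motive := fun _ => ℕ) (countOf p l) (countOf p l + 1) (p a) = _
      cases p a <;> rfl
    rw [h]
    cases p a <;> simp

theorem sum_vec {M : Type*} [AddCommMonoid M] (h : Vec 4 → M) :
    ∑ x, h x = ∑ i ∈ Finset.range 16, h (vec i) :=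
  Finset.sum_nbij' code vec (fun x _ => Finset.mem_range.mpr (code_lt x))
    (fun _ _ => Finset.mem_univ _) (fun x _ => vec_code x)
    (fun _ hi => code_vec (Finset.mem_range.mp hi)) (fun x _ => by rw [vec_code])

theorem card_filter_vec (p : Vec 4 → Prop) [DecidablePred p] :
    (Finset.univ.filter p).card = ∑ i ∈ Finset.range 16, if p (vec i) then 1 else 0 := by
  rw [Finset.card_filter, sum_vec]

theorem byteTable_eq {n : ℕ} (hn : n < 256) :
    Nat.land (Nat.shiftRight byteTable (Nat.mul 4 n)) 15 =
      ∑ i ∈ Finset.range 8, (n.testBit i).toNat := by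
  have h : ∀ n : Fin 256, Nat.land (Nat.shiftRight byteTable (Nat.mul 4 n)) 15 =
      ∑ i ∈ Finset.range 8, ((n : ℕ).testBit i).toNat := by
    decide +kernel
  exact h ⟨n, hn⟩

theorem weight_eq {n : ℕ} (hn : n < 2 ^ 16) :
    weight n = ∑ i ∈ Finset.range 16, (n.testBit i).toNat := by
  have e1 : Nat.land n 255 = n % 256 := Nat.and_two_pow_sub_one_eq_mod n 8
  have e2 : Nat.shiftRight n 8 = n / 256 := Nat.shiftRight_eq_div_pow n 8
  have h1 := byteTable_eq (n := n % 256) (by omega)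
  have h2 := byteTable_eq (n := n / 256) (by omega)
  have h3 : weight n = Nat.land (Nat.shiftRight byteTable (Nat.mul 4 (n % 256))) 15 +
      Nat.land (Nat.shiftRight byteTable (Nat.mul 4 (n / 256))) 15 := by
    rw [← e1, ← e2]
    rfl
  rw [h3, h1, h2, show (16 : ℕ) = 8 + 8 by norm_num, Finset.sum_range_add]
  congr 1
  · refine Finset.sum_congr rfl fun i hi => ?_
    have := Finset.mem_range.mp hi
    rw [show (256 : ℕ) = 2 ^ 8 by norm_num, Nat.testBit_mod_two_pow]
    simp [this]
  · refine Finset.sum_congr rfl fun i _ => ?_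
    rw [show (256 : ℕ) = 2 ^ 8 by norm_num, Nat.testBit_div_two_pow, add_comm]

theorem parity_eq : ∀ y b : Fin 16, parity (Nat.land y b) = (vec y ⬝ᵥ vec b).val := by
  decide +kernel

theorem testBit_linearTable {a x : ℕ} (ha : a < 16) (hx : x < 16) :
    (linearTable a).testBit x = decide (vec a ⬝ᵥ vec x = 1) := by
  have h : ∀ a x : Fin 16, (linearTable a).testBit x = decide (vec a ⬝ᵥ vec x = 1) := by
    decide +kernel
  exact h ⟨a, ha⟩ ⟨x, hx⟩

theorem linearTable_lt {a : ℕ} (ha : a < 16) : linearTable a < 2 ^ 16 := by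
  have h : ∀ a : Fin 16, linearTable a < 2 ^ 16 := by decide +kernel
  exact h ⟨a, ha⟩

/-- `G` is the graph of `f`. -/
structure IsGraph (f : Vec 4 → Vec 4) (G : List ℕ) : Prop where
  nodup : (G.map (· / 16)).Nodup
  lt : ∀ w ∈ G, w < 256
  agrees : Agrees f G
  mem_positions : ∀ x, x < 16 → x ∈ G.map (· / 16)

theorem parity_and_eq {w b : ℕ} (hb : b < 16) :
    parity (Nat.land (Nat.land w 15) b) = (vec (w % 16) ⬝ᵥ vec b).val := by
  have e1 : Nat.land w 15 = w % 16 := Nat.and_two_pow_sub_one_eq_mod w 4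
  rw [e1]
  exact parity_eq ⟨w % 16, by omega⟩ ⟨b, hb⟩

theorem zmod_val_eq (z : ZMod 2) : z.val = if z = 1 then 1 else 0 := by
  revert z
  decide

theorem componentTable_spec {b : ℕ} (hb : b < 16) {L : List ℕ} (hL : ∀ w ∈ L, w < 256) :
    componentTable L b < 2 ^ 16 ∧ ∀ x, ((componentTable L b).testBit x = true ↔
      ∃ w ∈ L, w / 16 = x ∧ vec (w % 16) ⬝ᵥ vec b = 1) := by
  induction L with
  | nil =>
    refine ⟨by change 0 < _; norm_num, fun x => ?_⟩
    change Nat.testBit 0 x = true ↔ _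
    simp
  | cons w L ih =>
    obtain ⟨h1, h2⟩ := ih fun v hv => hL v (List.mem_cons_of_mem _ hv)
    have hw := hL w List.mem_cons_self
    have h3 : componentTable (w :: L) b =
        (if vec (w % 16) ⬝ᵥ vec b = 1 then 1 else 0) * 2 ^ (w / 16) ||| componentTable L b := by
      change (parity (Nat.land (Nat.land w 15) b)) <<< (w >>> 4) ||| componentTable L b = _
      rw [parity_and_eq hb, zmod_val_eq, Nat.shiftLeft_eq, Nat.shiftRight_eq_div_pow]
    have h4 : 2 ^ (w / 16) < 2 ^ 16 := Nat.pow_lt_pow_right (by norm_num) (by omega)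
    refine ⟨?_, fun x => ?_⟩
    · rw [h3]
      refine Nat.or_lt_two_pow ?_ h1
      split <;> simp_all
    · rw [h3, Nat.testBit_or, Bool.or_eq_true, h2, List.exists_mem_cons_iff]
      refine or_congr_left ?_
      split
      · next h => simp [h, Nat.testBit_two_pow]
      · next h => simp [h]

namespace IsGraph

variable {f : Vec 4 → Vec 4} {G : List ℕ}

theorem testBit_componentTable (h : IsGraph f G) {b x : ℕ} (hb : b < 16) (hx : x < 16) :
    (componentTable G b).testBit x = decide (component f (vec b) (vec x) = 1) := by
  rw [Bool.eq_iff_iff, (componentTable_spec hb h.lt).2, decide_eq_true_eq, component]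
  constructor
  · rintro ⟨w, hw, rfl, h1⟩
    rwa [h.agrees w hw]
  · intro h1
    obtain ⟨w, hw, rfl⟩ := List.mem_map.mp (h.mem_positions x hx)
    refine ⟨w, hw, rfl, ?_⟩
    rwa [h.agrees w hw] at h1

theorem componentTable_lt (h : IsGraph f G) {b : ℕ} (hb : b < 16) :
    componentTable G b < 2 ^ 16 := (componentTable_spec hb h.lt).1

end IsGraph

theorem walsh_eq (g : Vec 4 → ZMod 2) (a : Vec 4) :
    walsh g a = 16 - 2 * ((Finset.univ.filter fun x => g x + a ⬝ᵥ x = 1).card : ℤ) := by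
  have h : ∀ z : ZMod 2, (-1 : ℤ) ^ z.val = 1 - 2 * if z = 1 then 1 else 0 := by decide
  rw [walsh, Finset.card_filter]
  simp only [h, Finset.sum_sub_distrib, ← Finset.mul_sum]
  simp

theorem IsGraph.natAbs_walsh {f : Vec 4 → Vec 4} {G : List ℕ} (h : IsGraph f G) {a b : ℕ}
    (ha : a < 16) (hb : b < 16) :
    (walsh (component f (vec b)) (vec a)).natAbs = absWalsh (componentTable G b) a := by
  have hw : weight (componentTable G b ^^^ linearTable a) =
      (Finset.univ.filter fun x => component f (vec b) x + vec a ⬝ᵥ x = 1).card := by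
    rw [weight_eq (xor_lt (h.componentTable_lt hb) (linearTable_lt ha)), card_filter_vec]
    refine Finset.sum_congr rfl fun x hx => ?_
    rw [Finset.mem_range] at hx
    rw [Nat.testBit_xor, h.testBit_componentTable hb hx, testBit_linearTable ha hx]
    have : ∀ y z : ZMod 2, (decide (y = 1) ^^ decide (z = 1)).toNat = if y + z = 1 then 1 else 0 := by
      decide
    exact this _ _
  rw [walsh_eq, ← hw]
  change _ = (16 - 2 * weight (componentTable G b ^^^ linearTable a)) +
    (2 * weight (componentTable G b ^^^ linearTable a) - 16)
  omega

theorem sup_eq_iff {α : Type*} {s : Finset α} {g : α → ℕ} {n : ℕ} (hn : n ≠ 0) :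
    s.sup g = n ↔ (∀ a ∈ s, g a ≤ n) ∧ ∃ a ∈ s, g a = n := by
  constructor
  · rintro rfl
    refine ⟨fun a ha => Finset.le_sup ha, ?_⟩
    rcases s.eq_empty_or_nonempty with rfl | hs
    · simp at hn
    · obtain ⟨a, ha, h⟩ := Finset.exists_mem_eq_sup s hs g
      exact ⟨a, ha, h.symm⟩
  · rintro ⟨h1, a, ha, rfl⟩
    exact le_antisymm (Finset.sup_le h1) (Finset.le_sup ha)

theorem mem_nonzero : ∀ n : ℕ, n ∈ nonzero ↔ n < 16 ∧ n ≠ 0 := by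
  intro n
  simp only [nonzero, List.mem_cons, List.not_mem_nil, or_false]
  omega

theorem mem_zero_nonzero (n : ℕ) : n ∈ 0 :: nonzero ↔ n < 16 := by
  rw [List.mem_cons, mem_nonzero]
  omega

theorem hammingNorm_eq_one (v : Vec 4) : hammingNorm v = 1 ↔ code v ∈ [1, 2, 4, 8] := by
  revert v
  decide +kernel

theorem code_eq_zero {v : Vec 4} : code v = 0 ↔ v = 0 := by
  rw [← code_inj, show code 0 = 0 by decide]

theorem IsGraph.lin_eq_iff {f : Vec 4 → Vec 4} {G : List ℕ} (h : IsGraph f G) :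
    Lin f = 8 ↔ testLin G = true ∧ testLin' G = true := by
  rw [Lin, sup_eq_iff (by norm_num), testLin, testLin', allOf_iff, anyOf_iff]
  simp only [allOf_iff, anyOf_iff, Finset.mem_filter, Finset.mem_univ, true_and, Prod.forall,
    Prod.exists, Nat.ble_eq, Nat.beq_eq, mem_zero_nonzero, mem_nonzero]
  refine and_congr ⟨fun H b hb a ha => ?_, fun H a b hb => ?_⟩ ⟨?_, ?_⟩
  · rw [← h.natAbs_walsh ha hb.1]
    refine H _ _ ?_
    rw [← vec_zero, Ne, vec_inj hb.1 (by norm_num)]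
    exact hb.2
  · rw [← vec_code a, ← vec_code b, h.natAbs_walsh (code_lt _) (code_lt _)]
    exact H _ ⟨code_lt _, by rwa [Ne, code_eq_zero]⟩ _ (code_lt _)
  · rintro ⟨a, b, hb, H⟩
    rw [← vec_code a, ← vec_code b, h.natAbs_walsh (code_lt _) (code_lt _)] at H
    exact ⟨_, ⟨code_lt _, by rwa [Ne, code_eq_zero]⟩, _, code_lt _, H⟩
  · rintro ⟨b, hb, a, ha, H⟩
    rw [← h.natAbs_walsh ha hb.1] at H
    refine ⟨_, _, ?_, H⟩
    rw [← vec_zero, Ne, vec_inj hb.1 (by norm_num)]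
    exact hb.2

theorem lt_of_mem_units {n : ℕ} (hn : n ∈ [1, 2, 4, 8]) : n < 16 := by
  simp only [List.mem_cons, List.not_mem_nil, or_false] at hn
  omega

theorem IsGraph.lin₁_eq_iff {f : Vec 4 → Vec 4} {G : List ℕ} (h : IsGraph f G) :
    Lin₁ f = 4 ↔ testLin₁ G = true ∧ testLin₁' G = true := by
  rw [Lin₁, sup_eq_iff (by norm_num), testLin₁, testLin₁', allOf_iff, anyOf_iff]
  simp only [allOf_iff, anyOf_iff, Finset.mem_filter, Finset.mem_univ, true_and, Prod.forall,
    Prod.exists, Nat.ble_eq, Nat.beq_eq, hammingNorm_eq_one]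
  refine and_congr ⟨fun H b hb a ha => ?_, fun H a b hab => ?_⟩ ⟨?_, ?_⟩
  · rw [← h.natAbs_walsh (lt_of_mem_units ha) (lt_of_mem_units hb)]
    refine H _ _ ?_
    rw [code_vec (lt_of_mem_units ha), code_vec (lt_of_mem_units hb)]
    exact ⟨ha, hb⟩
  · rw [← vec_code a, ← vec_code b, h.natAbs_walsh (code_lt _) (code_lt _)]
    exact H _ hab.2 _ hab.1
  · rintro ⟨a, b, hab, H⟩
    rw [← vec_code a, ← vec_code b, h.natAbs_walsh (code_lt _) (code_lt _)] at H
    exact ⟨_, hab.2, _, hab.1, H⟩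
  · rintro ⟨b, hb, a, ha, H⟩
    rw [← h.natAbs_walsh (lt_of_mem_units ha) (lt_of_mem_units hb)] at H
    refine ⟨_, _, ?_, H⟩
    rw [code_vec (lt_of_mem_units ha), code_vec (lt_of_mem_units hb)]
    exact ⟨ha, hb⟩

theorem IsGraph.card_solutions {f : Vec 4 → Vec 4} {G : List ℕ} (h : IsGraph f G) {u v : ℕ}
    (hu : u < 16) (hv : v < 16) (hu0 : u ≠ 0) :
    (solutions f (vec u) (vec v)).card = 2 * npairs G (16 * u + v) := by
  have := SBox.card_solutions h.nodup h.lt h.agrees h.mem_positions (i := 16 * u + v) (by omega)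
    (by omega)
  rwa [show (16 * u + v) / 16 = u by omega, show (16 * u + v) % 16 = v by omega] at this

theorem IsGraph.weaklyAPN_iff {f : Vec 4 → Vec 4} {G : List ℕ} (h : IsGraph f G) {S : ℕ}
    (hS : ∀ i, i < 256 → (S.testBit i = true ↔ 1 ≤ npairs G i)) :
    WeaklyAPN f ↔ testAPN S = true := by
  have key : ∀ u, u < 16 → u ≠ 0 → weight (Nat.land (Nat.shiftRight S (Nat.mul 16 u)) 65535) =
      (Finset.univ.image (derivative f (vec u))).card := by
    intro u hu hu0
    have e1 : Nat.land (Nat.shiftRight S (Nat.mul 16 u)) 65535 = (S >>> (16 * u)) % 2 ^ 16 :=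
      Nat.and_two_pow_sub_one_eq_mod _ 16
    have e2 : Finset.univ.image (derivative f (vec u)) =
        Finset.univ.filter fun v => 0 < (solutions f (vec u) v).card := by
      ext v
      simp [Finset.card_pos, Finset.Nonempty]
    rw [e1, weight_eq (Nat.mod_lt _ (by norm_num)), e2, card_filter_vec]
    refine Finset.sum_congr rfl fun v hv => ?_
    rw [Finset.mem_range] at hv
    rw [Nat.testBit_mod_two_pow, Nat.testBit_shiftRight, h.card_solutions hu hv hu0]
    have := hS (16 * u + v) (by omega)
    by_cases hn : 1 ≤ npairs G (16 * u + v)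
    · rw [this.mpr hn]
      simp [hv]
      omega
    · rw [show S.testBit (16 * u + v) = false by rw [← Bool.not_eq_true, this]; exact hn]
      simp
      omega
  rw [WeaklyAPN, WeaklyDifferentiallyUniform, testAPN, allOf_iff]
  simp only [Nat.ble_eq, mem_nonzero]
  have e3 : ∀ n : ℕ, (2 : ℚ) ^ (4 - 1) / ((2 : ℕ) : ℚ) < (n : ℚ) ↔ 5 ≤ n := by
    intro n
    rw [show (2 : ℚ) ^ (4 - 1) / ((2 : ℕ) : ℚ) = ((4 : ℕ) : ℚ) by norm_num, Nat.cast_lt]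
    rfl
  simp only [e3]
  constructor
  · intro H u hu
    rw [key u hu.1 hu.2]
    refine H _ ?_
    rw [← vec_zero, Ne, vec_inj hu.1 (by norm_num)]
    exact hu.2
  · intro H u hu
    have hu0 : code u ≠ 0 := by rwa [Ne, code_eq_zero]
    have := H _ ⟨code_lt u, hu0⟩
    rwa [key _ (code_lt u) hu0, vec_code] at this

theorem anfCoeff_eq_sum (g : Vec 4 → ZMod 2) (I : Finset (Fin 4)) :
    anfCoeff g I = ∑ x : Vec 4 with ∀ i ∉ I, x i = 0, g x := by
  rw [anfCoeff]
  refine Finset.sum_nbij' indicatorVec (fun x => Finset.univ.filter fun i => x i ≠ 0) ?_ ?_ ?_ ?_ ?_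
  · intro J hJ
    rw [Finset.mem_filter]
    refine ⟨Finset.mem_univ _, fun i hi => ?_⟩
    rw [indicatorVec, if_neg fun h => hi (Finset.mem_powerset.mp hJ h)]
  · intro x hx
    rw [Finset.mem_powerset]
    intro i hi
    by_contra h
    exact (Finset.mem_filter.mp hi).2 ((Finset.mem_filter.mp hx).2 i h)
  · intro J _
    ext i
    simp [indicatorVec]
  · exact fun x _ => indicatorVec_support x
  · exact fun _ _ => rfl

/-- The bijection merely permutes the arguments, so the sum equals that of the linear function ⟨·,
v⟩ over the whole space, which is zero. -/
theorem anfCoeff_univ {f : Vec 4 → Vec 4} (hf : Function.Bijective f) (v : Vec 4) :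
    anfCoeff (component f v) Finset.univ = 0 := by
  rw [anfCoeff_eq_sum]
  simp only [Finset.mem_univ, not_true_eq_false, false_imp_iff, implies_true, Finset.filter_true]
  have h1 : ∑ x, component f v x = ∑ x : Vec 4, x ⬝ᵥ v :=
    (Equiv.ofBijective f hf).sum_comp fun x : Vec 4 => x ⬝ᵥ v
  rw [h1]
  clear h1
  revert v
  decide +kernel

theorem degree_eq_three_iff {f : Vec 4 → Vec 4} (hf : Function.Bijective f) (v : Vec 4) :
    degree (component f v) = 3 ↔
      ∃ i : Fin 4, anfCoeff (component f v) (Finset.univ.erase i) ≠ 0 := by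
  rw [degree, sup_eq_iff (by norm_num)]
  simp only [Finset.mem_filter, Finset.mem_univ, true_and]
  constructor
  · rintro ⟨-, I, hI, h3⟩
    have : Iᶜ.card = 1 := by rw [Finset.card_compl, h3]; rfl
    obtain ⟨i, hi⟩ := Finset.card_eq_one.mp this
    refine ⟨i, ?_⟩
    rwa [← Finset.compl_singleton, ← hi, compl_compl]
  · rintro ⟨i, hi⟩
    refine ⟨fun I hI => ?_, _, hi, by simp⟩
    have h1 : I ≠ Finset.univ := by
      rintro rfl
      exact hI (anfCoeff_univ hf v)
    have := (Finset.card_lt_iff_ne_univ I).mpr h1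
    rw [Fintype.card_fin] at this
    omega

theorem testBit_halfTables : ∀ i : Fin 4, ∀ x : Fin 16,
    (halfTables.getD i 0).testBit x = decide (vec x i = 0) := by
  decide +kernel

theorem IsGraph.anfCoeff_erase {f : Vec 4 → Vec 4} {G : List ℕ} (h : IsGraph f G) {b : ℕ}
    (hb : b < 16) (i : Fin 4) :
    anfCoeff (component f (vec b)) (Finset.univ.erase i) =
      (weight (componentTable G b &&& halfTables.getD i 0) : ZMod 2) := by
  rw [anfCoeff_eq_sum, weight_eq (lt_of_le_of_lt Nat.and_le_left (h.componentTable_lt hb)),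
    Finset.sum_filter, sum_vec, Nat.cast_sum]
  refine Finset.sum_congr rfl fun x hx => ?_
  rw [Finset.mem_range] at hx
  have h1 := testBit_halfTables i ⟨x, hx⟩
  simp only at h1
  rw [Nat.testBit_and, h1, h.testBit_componentTable hb hx]
  simp only [Finset.mem_erase, Finset.mem_univ, and_true, not_not, forall_eq]
  have h2 : ∀ y z : ZMod 2, (if z = 0 then y else 0) =
      (((decide (y = 1) && decide (z = 0)).toNat : ℕ) : ZMod 2) := by
    decide
  exact h2 _ _

theorem sum_range_sixteen (q : ℕ → Bool) :
    ∑ i ∈ Finset.range 16, (if i ≠ 0 ∧ q i = true then 1 else 0) = nonzero.countP q := by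
  simp only [Finset.sum_range_succ, Finset.sum_range_zero, nonzero, List.countP_cons,
    List.countP_nil]
  norm_num
  ring

theorem IsGraph.le_numDegree_iff {f : Vec 4 → Vec 4} {G : List ℕ} (h : IsGraph f G)
    (hf : Function.Bijective f) : 14 ≤ numDegree 3 f ↔ testDegree G = true := by
  have key : ∀ b, b < 16 → (anyOf (fun m =>
      Nat.beq (Nat.land (weight (Nat.land (componentTable G b) m)) 1) 1) halfTables = true ↔
      degree (component f (vec b)) = 3) := by
    intro b hb
    rw [degree_eq_three_iff hf, anyOf_iff]
    have e : ∀ i : Fin 4, Nat.beq (Nat.land (weight (Nat.land (componentTable G b)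
        (halfTables.getD i 0))) 1) 1 = true ↔
        anfCoeff (component f (vec b)) (Finset.univ.erase i) ≠ 0 := by
      intro i
      rw [h.anfCoeff_erase hb, Nat.beq_eq]
      have e1 : ∀ n : ℕ, Nat.land n 1 = n % 2 := fun n => Nat.and_two_pow_sub_one_eq_mod n 1
      rw [e1, Ne, ZMod.natCast_eq_zero_iff]
      change weight (componentTable G b &&& halfTables.getD i 0) % 2 = 1 ↔ _
      omega
    constructor
    · rintro ⟨m, hm, h1⟩
      obtain ⟨i, hi, rfl⟩ := List.mem_iff_getElem.mp hm
      refine ⟨⟨i, hi⟩, (e _).mp ?_⟩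
      rwa [List.getD_eq_getElem _ _ hi]
    · rintro ⟨i, hi⟩
      have hlt : (i : ℕ) < halfTables.length := i.2
      refine ⟨_, List.getElem_mem hlt, ?_⟩
      have := (e i).mpr hi
      rwa [List.getD_eq_getElem _ _ hlt] at this
  have hcard : numDegree 3 f = countOf (fun b => anyOf (fun m =>
      Nat.beq (Nat.land (weight (Nat.land (componentTable G b) m)) 1) 1) halfTables) nonzero := by
    rw [numDegree, card_filter_vec, countOf_eq, ← sum_range_sixteen]
    refine Finset.sum_congr rfl fun b hb => ?_
    rw [Finset.mem_range] at hb
    simp only [key b hb, ← vec_zero, Ne, vec_inj hb (by norm_num : 0 < 16)]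
  rw [hcard, testDegree, Nat.ble_eq]

namespace IsGraph

variable {f : Vec 4 → Vec 4} {G : List ℕ}

/-- A collision would give a difference with nonzero first half and zero second half, which is
forbidden. -/
theorem bijective (h : IsGraph f G) (hA : Admissible G) : Function.Bijective f := by
  rw [← Finite.injective_iff_bijective]
  intro x y hxy
  by_contra hne
  have hu : code (x + y) ≠ 0 := by rwa [Ne, code_eq_zero, CharTwo.add_eq_zero]
  have h1 := h.card_solutions (code_lt (x + y)) (v := 0) (by norm_num) hu
  have h2 := (hA (16 * code (x + y) + 0) (by have := code_lt (x + y); omega)).2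
    ((forbidden_iff ⟨_, code_lt (x + y)⟩ 0 (by simpa [Fin.ext_iff] using hu)).mpr (Or.inl rfl))
  rw [h2, mul_zero, Finset.card_eq_zero, Finset.filter_eq_empty_iff] at h1
  apply h1 (Finset.mem_univ y)
  rw [derivative, vec_code, add_left_comm, add_self_vec, add_zero, hxy, add_self_vec, vec_zero]

theorem differentiallyUniform (h : IsGraph f G) (hA : Admissible G) :
    DifferentiallyUniform 4 f := by
  intro u hu v
  have hu' : code u ≠ 0 := by rwa [Ne, code_eq_zero]
  have h1 := h.card_solutions (code_lt u) (code_lt v) hu'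
  have h2 := (hA (16 * code u + code v) (by have := code_lt u; have := code_lt v; omega)).1
  rw [vec_code, vec_code] at h1
  exact h1.trans_le (by omega)

theorem diff₁_eq (h : IsGraph f G) (hA : Admissible G) : Diff₁ f = 0 := by
  rw [diff₁_eq_zero_iff]
  intro u v hu hv
  have hu' : code u ≠ 0 := by
    rw [Ne, code_eq_zero]
    rintro rfl
    simp at hu
  have h1 := h.card_solutions (code_lt u) (code_lt v) hu'
  have h2 := (hA (16 * code u + code v) (by have := code_lt u; have := code_lt v; omega)).2
    ((forbidden_iff ⟨_, code_lt u⟩ ⟨_, code_lt v⟩ (by simpa [Fin.ext_iff] using hu')).mpr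
      (Or.inr (by simpa only [vec_code] using And.intro hu hv)))
  rw [vec_code, vec_code] at h1
  rw [h1, h2]

end IsGraph

/-! ### Planes, hyperplanes and anti-invariance -/

/-- No plane through `0` is mapped to a plane by a function fixing `0`. -/
def MapsNoPlane (f : Vec 4 → Vec 4) : Prop :=
  ∀ a b : Vec 4, a ≠ 0 → b ≠ 0 → a ≠ b → f a + f b ≠ f (a + b)

theorem testBit_graphMask (L : List ℕ) (i : ℕ) :
    (graphMask L).testBit i = true ↔ i ∈ L := by
  induction L with
  | nil =>
    change Nat.testBit 0 i = true ↔ _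
    simp
  | cons w L ih =>
    change (1 <<< w ||| graphMask L).testBit i = true ↔ _
    rw [Nat.testBit_or, Bool.or_eq_true, ih, Nat.shiftLeft_eq, one_mul, Nat.testBit_two_pow,
      decide_eq_true_eq, List.mem_cons, eq_comm]

theorem testPlanes_iff (G : List ℕ) : testPlanes G = true ↔
    ∀ v ∈ G, v ≠ 0 → ∀ w ∈ G, w ≠ 0 → v ≠ w → v ^^^ w ∉ G := by
  have e : ∀ i, Nat.beq (Nat.land (Nat.shiftRight (graphMask G) i) 1) 0 = true ↔ i ∉ G := by
    intro i
    rw [← testBit_graphMask, Nat.testBit_eq_decide_div_mod_eq, Nat.beq_eq]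
    change (graphMask G >>> i) &&& 1 = 0 ↔ _
    rw [Nat.and_one_is_mod, Nat.shiftRight_eq_div_pow, decide_eq_true_eq]
    omega
  have hrec : ∀ b c : Bool, Bool.rec (motive := fun _ => Bool) c true b = true ↔
      (b ≠ true → c = true) := by
    decide
  rw [testPlanes, allOf_iff]
  simp only [hrec, allOf_iff, e, ne_eq, Nat.beq_eq]
  rfl

theorem IsGraph.mem_iff {f : Vec 4 → Vec 4} {G : List ℕ} (h : IsGraph f G) {w : ℕ} (hw : w < 256) :
    w ∈ G ↔ f (vec (w / 16)) = vec (w % 16) := by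
  refine ⟨h.agrees w, fun H => ?_⟩
  obtain ⟨v, hv, hvw⟩ := List.mem_map.mp (h.mem_positions (w / 16) (by omega))
  have h1 := h.agrees v hv
  rw [hvw, H, vec_inj (by omega) (by omega)] at h1
  have : v = w := by omega
  rwa [← this]

theorem IsGraph.mapsNoPlane_iff {f : Vec 4 → Vec 4} {G : List ℕ} (h : IsGraph f G) (h0 : 0 ∈ G) :
    MapsNoPlane f ↔ testPlanes G = true := by
  rw [testPlanes_iff, MapsNoPlane]
  have hmem : ∀ a : Vec 4, 16 * code a + code (f a) ∈ G := by
    intro a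
    have h1 := code_lt a
    have h2 := code_lt (f a)
    rw [h.mem_iff (by omega), show (16 * code a + code (f a)) / 16 = code a by omega,
      show (16 * code a + code (f a)) % 16 = code (f a) by omega, vec_code, vec_code]
  have hz : ∀ w ∈ G, w ≠ 0 → vec (w / 16) ≠ 0 := by
    intro w hw hw0 H
    exact hw0 (code_injOn h.nodup h.lt hw h0 (by rw [H, Nat.zero_div, vec_zero]))
  constructor
  · intro H v hv hv0 w hw hw0 hvw hmem
    refine H _ _ (hz v hv hv0) (hz w hw hw0) (fun h1 => hvw (code_injOn h.nodup h.lt hv hw h1)) ?_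
    have h1 := h.agrees _ hmem
    rw [xor_div_sixteen, xor_mod_sixteen, vec_xor, vec_xor] at h1
    rw [h1, h.agrees v hv, h.agrees w hw]
  · intro H a b ha hb hab h1
    have ha' : code a ≠ 0 := by rwa [Ne, code_eq_zero]
    have hb' : code b ≠ 0 := by rwa [Ne, code_eq_zero]
    have hab' : code a ≠ code b := by rwa [Ne, code_inj]
    have l1 := code_lt (f a)
    have l2 := code_lt (f b)
    have l3 := code_lt a
    have l4 := code_lt b
    refine H _ (hmem a) (by omega) _ (hmem b) (by omega) (by omega) ?_
    have := hmem (a + b)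
    have e1 : (16 * code a + code (f a)) ^^^ (16 * code b + code (f b)) =
        16 * code (a + b) + code (f (a + b)) := by
      have e2 := xor_div_sixteen (16 * code a + code (f a)) (16 * code b + code (f b))
      have e3 := xor_mod_sixteen (16 * code a + code (f a)) (16 * code b + code (f b))
      rw [show (16 * code a + code (f a)) / 16 = code a by omega,
        show (16 * code b + code (f b)) / 16 = code b by omega, ← code_add] at e2
      rw [show (16 * code a + code (f a)) % 16 = code (f a) by omega,
        show (16 * code b + code (f b)) % 16 = code (f b) by omega, ← code_add, h1] at e3
      omega
    rwa [e1]

/-- A hyperplane is the orthogonal space of a vector. -/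
theorem exists_dotProduct_eq_zero {V : Submodule (ZMod 2) (Vec 4)}
    (hV : Module.finrank (ZMod 2) V = 3) :
    ∃ a : Vec 4, a ≠ 0 ∧ ∀ x, x ∈ V ↔ a ⬝ᵥ x = 0 := by
  have hfin : Module.finrank (ZMod 2) (Vec 4) = 4 := by simp
  have hlt : V < ⊤ := by
    rw [lt_top_iff_ne_top]
    rintro rfl
    rw [finrank_top, hfin] at hV
    norm_num at hV
  obtain ⟨g, hg0, hg⟩ := Submodule.exists_le_ker_of_lt_top V hlt
  have hga : ∀ x, g x = (fun i => g (Pi.single i 1)) ⬝ᵥ x := by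
    intro x
    conv_lhs => rw [← Finset.univ_sum_single x]
    rw [map_sum, dotProduct]
    refine Finset.sum_congr rfl fun i _ => ?_
    rw [mul_comm, ← smul_eq_mul, ← map_smul, ← Pi.single_smul, smul_eq_mul, mul_one]
  have hker : V = LinearMap.ker g := by
    refine Submodule.eq_of_le_of_finrank_le hg ?_
    have h1 := Submodule.finrank_lt fun h => hg0 (LinearMap.ker_eq_top.mp h)
    rw [hfin] at h1
    omega
  refine ⟨fun i => g (Pi.single i 1), fun h => hg0 ?_, fun x => ?_⟩
  · ext x
    rw [LinearMap.comp_apply]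
    simpa using congrFun h x
  · rw [hker, LinearMap.mem_ker, hga]

theorem card_eq_two_pow (V : Submodule (ZMod 2) (Vec 4)) :
    Nat.card V = 2 ^ Module.finrank (ZMod 2) V := by
  rw [Module.natCard_eq_pow_finrank (K := ZMod 2), Nat.card_zmod]

theorem exists_of_finrank_eq_two {V : Submodule (ZMod 2) (Vec 4)}
    (hV : Module.finrank (ZMod 2) V = 2) :
    ∃ a ∈ V, ∃ b ∈ V, a ≠ 0 ∧ b ≠ 0 ∧ a ≠ b ∧ ∀ x ∈ V, x = 0 ∨ x = a ∨ x = b ∨ x = a + b := by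
  classical
  have hc : Nat.card V = 4 := by rw [card_eq_two_pow, hV]; rfl
  have hc' : (V : Set (Vec 4)).toFinset.card = 4 := by
    rw [Set.toFinset_card]
    exact Nat.card_eq_fintype_card.symm.trans hc
  set s := (V : Set (Vec 4)).toFinset with hs
  have hmem : ∀ x, x ∈ s ↔ x ∈ V := fun x => by simp [hs]
  have h1 : 0 < (s.erase 0).card := by
    rw [Finset.card_erase_of_mem ((hmem 0).mpr V.zero_mem), hc']
    norm_num
  obtain ⟨a, ha⟩ := Finset.card_pos.mp h1
  have h2 : 0 < ((s.erase 0).erase a).card := by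
    rw [Finset.card_erase_of_mem ha, Finset.card_erase_of_mem ((hmem 0).mpr V.zero_mem), hc']
    norm_num
  obtain ⟨b, hb⟩ := Finset.card_pos.mp h2
  simp only [Finset.mem_erase, hmem] at ha hb
  refine ⟨a, ha.2, b, hb.2.2, ha.1, hb.2.1, Ne.symm hb.1, ?_⟩
  have hab : a + b ≠ 0 := fun h => hb.1 (CharTwo.add_eq_zero.mp h).symm
  have hsub : ({0, a, b, a + b} : Finset (Vec 4)) ⊆ s := by
    intro x hx
    simp only [Finset.mem_insert, Finset.mem_singleton] at hx
    rw [hmem]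
    rcases hx with rfl | rfl | rfl | rfl
    exacts [V.zero_mem, ha.2, hb.2.2, V.add_mem ha.2 hb.2.2]
  have hcard : ({0, a, b, a + b} : Finset (Vec 4)).card = 4 := by
    rw [Finset.card_insert_of_notMem, Finset.card_insert_of_notMem, Finset.card_insert_of_notMem,
      Finset.card_singleton]
    · simpa using ha.1
    · simp only [Finset.mem_insert, Finset.mem_singleton, left_eq_add, not_or]
      exact ⟨Ne.symm hb.1, hb.2.1⟩
    · simp only [Finset.mem_insert, Finset.mem_singleton, not_or]
      exact ⟨Ne.symm ha.1, Ne.symm hb.2.1, Ne.symm hab⟩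
  have := Finset.eq_of_subset_of_card_le hsub (by rw [hcard, hc'])
  intro x hx
  rw [← hmem, ← this] at hx
  simpa only [Finset.mem_insert, Finset.mem_singleton] using hx

theorem span_pair_eq (a b : Vec 4) : (Submodule.span (ZMod 2) {a, b} : Set (Vec 4)) =
    {0, a, b, a + b} := by
  ext x
  rw [SetLike.mem_coe, Submodule.mem_span_pair]
  simp only [Set.mem_insert_iff, Set.mem_singleton_iff]
  constructor
  · rintro ⟨c, d, rfl⟩
    have h : ∀ c : ZMod 2, c = 0 ∨ c = 1 := by decide
    rcases h c with rfl | rfl <;> rcases h d with rfl | rfl <;> simp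
  · rintro (rfl | rfl | rfl | rfl)
    exacts [⟨0, 0, by simp⟩, ⟨1, 0, by simp⟩, ⟨0, 1, by simp⟩, ⟨1, 1, by simp⟩]

theorem finrank_span_pair {a b : Vec 4} (ha : a ≠ 0) (hb : b ≠ 0) (hab : a ≠ b) :
    Module.finrank (ZMod 2) (Submodule.span (ZMod 2) {a, b}) = 2 := by
  have h : LinearIndependent (ZMod 2) ![a, b] := by
    rw [LinearIndependent.pair_iff]
    intro c d hcd
    have h : ∀ c : ZMod 2, c = 0 ∨ c = 1 := by decide
    rcases h c with rfl | rfl <;> rcases h d with rfl | rfl <;> simp_all [CharTwo.add_eq_zero]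
  have := finrank_span_eq_card h
  rwa [Matrix.range_cons_cons_empty] at this

theorem natAbs_walsh_le_lin (f : Vec 4 → Vec 4) {a b : Vec 4} (hb : b ≠ 0) :
    (walsh (component f b) a).natAbs ≤ Lin f :=
  Finset.le_sup (f := fun p : Vec 4 × Vec 4 => (walsh (component f p.2) p.1).natAbs) (b := (a, b))
    (Finset.mem_filter.mpr ⟨Finset.mem_univ _, hb⟩)

/-- By injectivity `V` and `W` have equal dimension. Dimensions 0 and 1 are permitted and dimension
4 is the whole space; dimension 3 contradicts `Lin f = 8`, so only planes are left. -/
theorem IsStrong.stronglyAntiInvariant_iff {f : Vec 4 → Vec 4} (hf : IsStrong f) (h0 : f 0 = 0) :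
    StronglyAntiInvariant 2 f ↔ MapsNoPlane f := by
  have hinj := hf.bijective.injective
  constructor
  · intro H a b ha hb hab h
    have hfa : f a ≠ 0 := fun h => ha (hinj (h.trans h0.symm))
    have hfb : f b ≠ 0 := fun h => hb (hinj (h.trans h0.symm))
    have hfab : f a ≠ f b := fun h => hab (hinj h)
    have h1 := H (Submodule.span (ZMod 2) {a, b}) (Submodule.span (ZMod 2) {f a, f b}) (by
      rw [span_pair_eq, span_pair_eq]
      simp only [Set.image_insert_eq, Set.image_singleton, h0, h])
    have h2 := finrank_span_pair hfa hfb hfab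
    rcases h1 with h1 | h1
    · omega
    · rw [h1.2, finrank_top] at h2
      simp at h2
  · intro H V W hVW
    have hcard : Nat.card V = Nat.card W := by
      have h1 := Nat.card_image_of_injective hinj (V : Set (Vec 4))
      rw [hVW] at h1
      exact h1.symm
    have hrank : Module.finrank (ZMod 2) V = Module.finrank (ZMod 2) W := by
      rw [card_eq_two_pow, card_eq_two_pow] at hcard
      exact Nat.pow_right_injective le_rfl hcard
    have hle : Module.finrank (ZMod 2) V ≤ 4 := by
      have := Submodule.finrank_le V
      simpa using this
    have hVW' : ∀ x, x ∈ V ↔ f x ∈ W := by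
      intro x
      rw [← SetLike.mem_coe (p := W), ← hVW, hinj.mem_set_image, SetLike.mem_coe]
    have h2 : Module.finrank (ZMod 2) V ≠ 2 := by
      intro hV
      obtain ⟨a, ha, b, hb, ha0, hb0, hab, -⟩ := exists_of_finrank_eq_two hV
      obtain ⟨c, -, d, -, -, -, -, hcd⟩ := exists_of_finrank_eq_two (hrank ▸ hV)
      have hfa : f a ≠ 0 := fun h => ha0 (hinj (h.trans h0.symm))
      have hfb : f b ≠ 0 := fun h => hb0 (hinj (h.trans h0.symm))
      have hfab : f a ≠ f b := fun h => hab (hinj h)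
      have hx : ∀ x ∈ V, x ≠ 0 → f x = c ∨ f x = d ∨ f x = c + d := fun x hx hx0 =>
        (hcd _ ((hVW' x).mp hx)).resolve_left fun h => hx0 (hinj (h.trans h0.symm))
      have habs : a + b ≠ 0 := fun h => hab (CharTwo.add_eq_zero.mp h)
      have e1 : f (a + b) ≠ f a := fun h => hb0 (add_eq_left.mp (hinj h))
      have e2 : f (a + b) ≠ f b := fun h => ha0 (add_eq_right.mp (hinj h))
      have e3 : c + (c + d) = d := by rw [← add_assoc, add_self_vec, zero_add]
      have e4 : d + (c + d) = c := by rw [add_left_comm, add_self_vec, add_zero]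
      apply H a b ha0 hb0 hab
      have k1 := hx a ha ha0
      have k2 := hx b hb hb0
      have k3 := hx (a + b) (V.add_mem ha hb) habs
      -- The images of `a`, `b`, `a + b` are the elements `c`, `d`, `c + d` in some order, and any
      -- two of these add up to the third.
      rcases k1 with k1 | k1 | k1 <;> rcases k2 with k2 | k2 | k2 <;>
        rcases k3 with k3 | k3 | k3 <;> simp_all [add_comm]
    have h3 : Module.finrank (ZMod 2) V ≠ 3 := by
      intro hV
      obtain ⟨a, -, ha⟩ := exists_dotProduct_eq_zero hV
      obtain ⟨b, hb0, hb⟩ := exists_dotProduct_eq_zero (hrank ▸ hV)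
      have h4 := natAbs_walsh_le_lin f (a := a) hb0
      -- The component of `f` at `b` and the function ⟨a, ·⟩ both vanish exactly on `V`, so they
      -- coincide and all sixteen terms are 1.
      have h5 : walsh (component f b) a = 16 := by
        have h6 : ∀ x, component f b x + a ⬝ᵥ x = 0 := by
          intro x
          have h7 : ∀ y z : ZMod 2, (y = 0 ↔ z = 0) → z + y = 0 := by decide
          refine h7 _ _ ?_
          rw [← ha, hVW', hb, component, dotProduct_comm]
        rw [walsh_eq]
        simp [h6]
      rw [h5, hf.lin_eq] at h4
      norm_num at h4
    rcases Nat.lt_or_ge (Module.finrank (ZMod 2) V) 2 with h4 | h4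
    · exact Or.inl ⟨hrank, by omega⟩
    · right
      have h5 : Module.finrank (ZMod 2) V = Module.finrank (ZMod 2) (Vec 4) := by
        rw [Module.finrank_fin_fun]
        omega
      exact ⟨Submodule.eq_top_of_finrank_eq h5, Submodule.eq_top_of_finrank_eq (hrank ▸ h5)⟩

/-! ### Correctness at the leaves -/

open Classical in
/-- One for the strong functions, increased by `2 ^ 65` for the very strong ones. -/
noncomputable def indicator (f : Vec 4 → Vec 4) : ℕ :=
  if IsStrong f then if IsVeryStrong f then 36893488147419103233 else 1 else 0

theorem restricts_indicator : Restricts indicator := fun _ h => if_neg h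

theorem total_eq {Φ : (Vec 4 → Vec 4) → ℕ} {f : Vec 4 → Vec 4} {G : List ℕ} (h : IsGraph f G) :
    total Φ G = Φ f := by
  refine Finset.sum_eq_single f (fun g hg hne => absurd ?_ hne) fun hf => absurd ?_ hf
  · funext x
    obtain ⟨w, hw, hwx⟩ := List.mem_map.mp (h.mem_positions _ (code_lt x))
    have h1 := (Finset.mem_filter.mp hg).2 w hw
    have h2 := h.agrees w hw
    rw [hwx, vec_code] at h1 h2
    rw [h1, h2]
  · exact Finset.mem_filter.mpr ⟨Finset.mem_univ _, h.agrees⟩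

theorem exists_isGraph {G : List ℕ} (hG : (G.map (· / 16)).Nodup) (hlt : ∀ w ∈ G, w < 256)
    (hall : ∀ x, x < 16 → x ∈ G.map (· / 16)) : ∃ f, IsGraph f G := by
  have h : ∀ x : Vec 4, ∃ w ∈ G, w / 16 = code x := fun x => List.mem_map.mp (hall _ (code_lt x))
  choose g hg hgx using h
  refine ⟨fun x => vec (g x % 16), hG, hlt, fun w hw => ?_, hall⟩
  have h1 := hlt w hw
  have : g (vec (w / 16)) = w :=
    code_injOn hG hlt (hg _) hw (by rw [hgx, code_vec (by omega)])
  rw [this]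

/-- All sixteen positions are filled, so the sum has a single term. Admissibility supplies the
conditions left untested, and the code 0 in `G` gives `f 0 = 0`, on which the plane criterion
depends. -/
theorem computes_leaf :
    Computes indicator leaf [15, 14, 13, 12, 11, 10, 9, 7, 6, 5, 3, 8, 4, 2, 1, 0] := by
  intro F S Z G hD hA h0 hG
  have hall : ∀ x, x < 16 → x ∈ G.map (· / 16) := by
    rw [hG]
    decide
  obtain ⟨f, hf⟩ := exists_isGraph hD.nodup hD.lt hall
  have hf0 : f 0 = 0 := by simpa only [Nat.zero_div, Nat.zero_mod, vec_zero] using hf.agrees 0 h0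
  have hbij := hf.bijective hA
  have hstrong : IsStrong f ↔ testAPN S = true ∧ testDegree G = true ∧ testLin₁ G = true ∧
      testLin G = true ∧ testLin' G = true ∧ testLin₁' G = true := by
    have k1 := hf.weaklyAPN_iff hD.testBit_S
    have k2 := hf.le_numDegree_iff hbij
    have k3 := hf.lin_eq_iff
    have k4 := hf.lin₁_eq_iff
    constructor
    · intro h
      have k5 := k3.mp h.lin_eq
      have k6 := k4.mp h.lin₁_eq
      exact ⟨k1.mp h.weaklyAPN, k2.mp h.le_numDegree, k6.1, k5.1, k5.2, k6.2⟩
    · rintro ⟨l1, l2, l3, l4, l5, l6⟩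
      exact ⟨hbij, k1.mpr l1, hf.differentiallyUniform hA, k3.mpr ⟨l4, l5⟩, hf.diff₁_eq hA,
        k4.mpr ⟨l3, l6⟩, k2.mpr l2⟩
  have hvery : IsStrong f → (IsVeryStrong f ↔ testPlanes G = true) := by
    intro h
    rw [← hf.mapsNoPlane_iff h0, ← h.stronglyAntiInvariant_iff hf0]
    exact ⟨fun h' => h'.stronglyAntiInvariant, fun h' => ⟨h, h'⟩⟩
  have hleaf : leaf F S Z G = if testAPN S = true ∧ testDegree G = true ∧ testLin₁ G = true ∧
      testLin G = true ∧ testLin' G = true ∧ testLin₁' G = true then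
      if testPlanes G = true then 36893488147419103233 else 1 else 0 := by
    rw [leaf]
    generalize testAPN S = b1
    generalize testDegree G = b2
    generalize testLin₁ G = b3
    generalize testLin G = b4
    generalize testLin' G = b5
    generalize testLin₁' G = b6
    generalize testPlanes G = b7
    cases b1 <;> cases b2 <;> cases b3 <;> cases b4 <;> cases b5 <;> cases b6 <;> cases b7 <;> rfl
  rw [total_eq hf, hleaf, indicator]
  by_cases hs : IsStrong f
  · rw [if_pos hs, if_pos (hstrong.mp hs)]
    simp only [hvery hs]
  · rw [if_neg hs, if_neg fun h => hs (hstrong.mpr h)]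

/-! ### Permutations of the coordinates -/

/-- The function `f`, with the coordinates of the argument permuted by `σ` and those of the value
permuted by `τ`. -/
def act (τ σ : Equiv.Perm (Fin 4)) (f : Vec 4 → Vec 4) : Vec 4 → Vec 4 :=
  fun x => f (x ∘ σ) ∘ τ

theorem act_symm_act (τ σ : Equiv.Perm (Fin 4)) (f : Vec 4 → Vec 4) :
    act τ.symm σ.symm (act τ σ f) = f := by
  funext x i
  simp [act, Function.comp_def]

theorem act_act_symm (τ σ : Equiv.Perm (Fin 4)) (f : Vec 4 → Vec 4) :
    act τ σ (act τ.symm σ.symm f) = f := by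
  funext x i
  simp [act, Function.comp_def]

theorem comp_bijective (σ : Equiv.Perm (Fin 4)) :
    Function.Bijective fun x : Vec 4 => x ∘ σ :=
  (Equiv.arrowCongr σ.symm (Equiv.refl (ZMod 2))).bijective

theorem zero_comp (σ : Equiv.Perm (Fin 4)) : (0 : Vec 4) ∘ σ = 0 := rfl

theorem act_zero {f : Vec 4 → Vec 4} (h0 : f 0 = 0) (τ σ : Equiv.Perm (Fin 4)) :
    act τ σ f 0 = 0 := by
  rw [act, zero_comp, h0, zero_comp]

theorem derivative_act (τ σ : Equiv.Perm (Fin 4)) (f : Vec 4 → Vec 4) (u x : Vec 4) :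
    derivative (act τ σ f) u x = derivative f (u ∘ σ) (x ∘ σ) ∘ τ := rfl

theorem comp_eq_zero {σ : Equiv.Perm (Fin 4)} {u : Vec 4} : u ∘ σ = 0 ↔ u = 0 := by
  rw [← zero_comp σ, (comp_bijective σ).injective.eq_iff, zero_comp]

theorem comp_comp_symm (σ : Equiv.Perm (Fin 4)) (x : Vec 4) : (x ∘ σ.symm) ∘ σ = x := by
  funext i
  simp

theorem card_filter_comp (σ : Equiv.Perm (Fin 4)) (p : Vec 4 → Prop) [DecidablePred p] :
    (Finset.univ.filter fun x : Vec 4 => p (x ∘ σ)).card = (Finset.univ.filter p).card :=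
  Finset.card_bijective _ (comp_bijective σ) fun x => by simp

theorem sum_comp_perm {M : Type*} [AddCommMonoid M] (σ : Equiv.Perm (Fin 4)) (h : Vec 4 → M) :
    ∑ x : Vec 4, h (x ∘ σ) = ∑ x, h x :=
  Function.Bijective.sum_comp (comp_bijective σ) h

theorem card_solutions_act (τ σ : Equiv.Perm (Fin 4)) (f : Vec 4 → Vec 4) (u v : Vec 4) :
    (solutions (act τ σ f) u v).card = (solutions f (u ∘ σ) (v ∘ τ.symm)).card := by
  refine Eq.trans (congrArg Finset.card (Finset.filter_congr fun x _ => ?_))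
    (card_filter_comp σ fun x => derivative f (u ∘ σ) x = v ∘ τ.symm)
  rw [derivative_act, ← (comp_bijective τ).injective.eq_iff (b := v ∘ τ.symm), comp_comp_symm]

theorem card_image_derivative_act (τ σ : Equiv.Perm (Fin 4)) (f : Vec 4 → Vec 4) (u : Vec 4) :
    (Finset.univ.image (derivative (act τ σ f) u)).card =
      (Finset.univ.image (derivative f (u ∘ σ))).card := by
  have h : derivative (act τ σ f) u =
      (fun x : Vec 4 => x ∘ τ) ∘ derivative f (u ∘ σ) ∘ fun x : Vec 4 => x ∘ σ := rfl
  rw [h, ← Finset.image_image, Finset.card_image_of_injective _ (comp_bijective τ).injective,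
    ← Finset.image_image, Finset.image_univ_of_surjective (comp_bijective σ).surjective]

theorem hammingNorm_comp (σ : Equiv.Perm (Fin 4)) (x : Vec 4) :
    hammingNorm (x ∘ σ) = hammingNorm x :=
  Finset.card_bijective σ σ.bijective fun i => by simp

theorem component_act (τ σ : Equiv.Perm (Fin 4)) (f : Vec 4 → Vec 4) (b : Vec 4) :
    component (act τ σ f) b = fun x => component f (b ∘ τ.symm) (x ∘ σ) := by
  funext x
  rw [component, component, act]
  conv_lhs => rw [← comp_comp_symm τ b]
  exact comp_equiv_dotProduct_comp_equiv _ _ τ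

theorem walsh_act (τ σ : Equiv.Perm (Fin 4)) (f : Vec 4 → Vec 4) (a b : Vec 4) :
    walsh (component (act τ σ f) b) a = walsh (component f (b ∘ τ.symm)) (a ∘ σ) := by
  rw [walsh, walsh]
  refine Eq.trans (Finset.sum_congr rfl fun (x : Vec 4) _ => ?_) (sum_comp_perm σ fun x =>
    (-1) ^ (component f (b ∘ τ.symm) x + (a ∘ σ) ⬝ᵥ x).val)
  rw [component_act]
  have h : a ⬝ᵥ x = (a ∘ σ) ⬝ᵥ (x ∘ σ) := (comp_equiv_dotProduct_comp_equiv a x σ).symm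
  rw [h]

theorem lin_act_le (τ σ : Equiv.Perm (Fin 4)) (f : Vec 4 → Vec 4) : Lin (act τ σ f) ≤ Lin f := by
  refine Finset.sup_le fun p hp => ?_
  rw [walsh_act]
  exact natAbs_walsh_le_lin f (comp_eq_zero.not.mpr (Finset.mem_filter.mp hp).2)

/-- The inverse permutations recover `f`, so the inequality valid for every function yields
equality. -/
theorem lin_act (τ σ : Equiv.Perm (Fin 4)) (f : Vec 4 → Vec 4) : Lin (act τ σ f) = Lin f := by
  refine le_antisymm (lin_act_le τ σ f) ?_
  conv_lhs => rw [← act_symm_act τ σ f]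
  exact lin_act_le _ _ _

theorem lin₁_act_le (τ σ : Equiv.Perm (Fin 4)) (f : Vec 4 → Vec 4) :
    Lin₁ (act τ σ f) ≤ Lin₁ f := by
  refine Finset.sup_le fun p hp => ?_
  rw [walsh_act]
  have h := (Finset.mem_filter.mp hp).2
  exact Finset.le_sup (f := fun p : Vec 4 × Vec 4 => (walsh (component f p.2) p.1).natAbs)
    (b := (p.1 ∘ σ, p.2 ∘ τ.symm)) (Finset.mem_filter.mpr ⟨Finset.mem_univ _,
      by rw [hammingNorm_comp]; exact h.1, by rw [hammingNorm_comp]; exact h.2⟩)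

theorem lin₁_act (τ σ : Equiv.Perm (Fin 4)) (f : Vec 4 → Vec 4) : Lin₁ (act τ σ f) = Lin₁ f := by
  refine le_antisymm (lin₁_act_le τ σ f) ?_
  conv_lhs => rw [← act_symm_act τ σ f]
  exact lin₁_act_le _ _ _

theorem anfCoeff_comp (σ : Equiv.Perm (Fin 4)) (g : Vec 4 → ZMod 2) (I : Finset (Fin 4)) :
    anfCoeff (fun x => g (x ∘ σ)) I = anfCoeff g (I.map σ.symm.toEmbedding) := by
  rw [anfCoeff_eq_sum, anfCoeff_eq_sum, Finset.sum_filter, Finset.sum_filter]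
  refine Eq.trans (Finset.sum_congr rfl fun x _ => ?_) (sum_comp_perm σ _)
  refine if_congr ?_ rfl rfl
  rw [σ.symm.forall_congr_left]
  simp

theorem degree_comp_le (σ : Equiv.Perm (Fin 4)) (g : Vec 4 → ZMod 2) :
    degree (fun x => g (x ∘ σ)) ≤ degree g := by
  refine Finset.sup_le fun I hI => ?_
  rw [Finset.mem_filter, anfCoeff_comp] at hI
  rw [← Finset.card_map σ.symm.toEmbedding]
  exact Finset.le_sup (f := Finset.card) (Finset.mem_filter.mpr ⟨Finset.mem_univ _, hI.2⟩)

theorem degree_comp (σ : Equiv.Perm (Fin 4)) (g : Vec 4 → ZMod 2) :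
    degree (fun x => g (x ∘ σ)) = degree g := by
  refine le_antisymm (degree_comp_le σ g) ?_
  have := degree_comp_le σ.symm fun x => g (x ∘ σ)
  simpa only [comp_comp_symm] using this

theorem numDegree_act (τ σ : Equiv.Perm (Fin 4)) (f : Vec 4 → Vec 4) (n : ℕ) :
    numDegree n (act τ σ f) = numDegree n f := by
  refine Eq.trans (congrArg Finset.card (Finset.filter_congr fun v _ => ?_))
    (card_filter_comp τ.symm fun v => v ≠ 0 ∧ degree (component f v) = n)
  rw [component_act, degree_comp, Ne, Ne, comp_eq_zero]

/-- Coordinate permutations are linear and preserve both the Hamming weight and the scalar product,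
and nothing else enters the definition. -/
theorem IsStrong.act {f : Vec 4 → Vec 4} (h : IsStrong f) (τ σ : Equiv.Perm (Fin 4)) :
    IsStrong (act τ σ f) where
  bijective := (comp_bijective τ).comp (h.bijective.comp (comp_bijective σ))
  weaklyAPN := fun u hu => by
    rw [card_image_derivative_act]
    exact h.weaklyAPN _ (comp_eq_zero.not.mpr hu)
  differentiallyUniform := fun u hu v =>
    (card_solutions_act τ σ f u v).trans_le
      (h.differentiallyUniform _ (comp_eq_zero.not.mpr hu) _)
  lin_eq := (lin_act τ σ f).trans h.lin_eq
  diff₁_eq := by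
    rw [diff₁_eq_zero_iff]
    intro u v hu hv
    rw [card_solutions_act]
    exact diff₁_eq_zero_iff.mp h.diff₁_eq _ _ (by rwa [hammingNorm_comp])
      (by rwa [hammingNorm_comp])
  lin₁_eq := (lin₁_act τ σ f).trans h.lin₁_eq
  le_numDegree := h.le_numDegree.trans_eq (numDegree_act τ σ f 3).symm

theorem isStrong_act {f : Vec 4 → Vec 4} {τ σ : Equiv.Perm (Fin 4)} :
    IsStrong (act τ σ f) ↔ IsStrong f := by
  refine ⟨fun h => ?_, fun h => h.act τ σ⟩
  rw [← act_symm_act τ σ f]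
  exact h.act _ _

theorem MapsNoPlane.act {f : Vec 4 → Vec 4} (h : MapsNoPlane f) (τ σ : Equiv.Perm (Fin 4)) :
    MapsNoPlane (act τ σ f) := by
  intro a b ha hb hab H
  refine h (a ∘ σ) (b ∘ σ) (comp_eq_zero.not.mpr ha) (comp_eq_zero.not.mpr hb)
    ((comp_bijective σ).injective.ne hab) ((comp_bijective τ).injective H)

theorem mapsNoPlane_act {f : Vec 4 → Vec 4} {τ σ : Equiv.Perm (Fin 4)} :
    MapsNoPlane (act τ σ f) ↔ MapsNoPlane f := by
  refine ⟨fun h => ?_, fun h => h.act τ σ⟩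
  rw [← act_symm_act τ σ f]
  exact h.act _ _

theorem isVeryStrong_iff {f : Vec 4 → Vec 4} (h0 : f 0 = 0) :
    IsVeryStrong f ↔ IsStrong f ∧ MapsNoPlane f := by
  constructor
  · intro h
    exact ⟨h.isStrong, (h.isStrong.stronglyAntiInvariant_iff h0).mp h.stronglyAntiInvariant⟩
  · rintro ⟨h1, h2⟩
    exact ⟨h1, (h1.stronglyAntiInvariant_iff h0).mpr h2⟩

-- `f 0 = 0` is used because very strong functions are recognised through `MapsNoPlane`, a criterion
-- for functions fixing 0.
open Classical in
theorem indicator_act {f : Vec 4 → Vec 4} (h0 : f 0 = 0) (τ σ : Equiv.Perm (Fin 4)) :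
    indicator (act τ σ f) = indicator f := by
  have h : MapsNoPlane (act τ σ f) ↔ MapsNoPlane f := mapsNoPlane_act
  have h' : IsStrong (act τ σ f) ↔ IsStrong f := isStrong_act
  have h'' : IsVeryStrong (act τ σ f) ↔ IsVeryStrong f := by
    rw [isVeryStrong_iff h0, isVeryStrong_iff (act_zero h0 τ σ), h, h']
  exact if_congr h' (if_congr h'' rfl rfl) rfl

/-! ### The values at the unit vectors -/

/-- The codes of the values of `f` at the unit vectors. -/
def basisValues (f : Vec 4 → Vec 4) : Fin 4 → ℕ := fun i => code (f (vec (2 ^ (i : ℕ))))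

theorem vec_two_pow_comp (σ : Equiv.Perm (Fin 4)) (i : Fin 4) :
    vec (2 ^ (i : ℕ)) ∘ σ = vec (2 ^ (σ.symm i : ℕ)) := by
  funext j
  simp only [vec, Function.comp_apply, Nat.testBit_two_pow, decide_eq_true_eq, Fin.val_inj]
  exact if_congr σ.symm_apply_eq.symm rfl rfl

/-- The number whose binary digits are the last four digits of `n`, permuted by `τ`. -/
def permuteBits (τ : Equiv.Perm (Fin 4)) (n : ℕ) : ℕ :=
  (n.testBit (τ 0)).toNat + 2 * (n.testBit (τ 1)).toNat + 4 * (n.testBit (τ 2)).toNat +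
    8 * (n.testBit (τ 3)).toNat

theorem permuteBits_code (τ : Equiv.Perm (Fin 4)) (v : Vec 4) :
    permuteBits τ (code v) = code (v ∘ τ) := by
  have h : ∀ i, ((code v).testBit (i : Fin 4)).toNat = (v i).val := by
    intro i
    conv_rhs => rw [← vec_code v, vec]
    cases (code v).testBit i <;> rfl
  simp only [permuteBits, h]
  rfl

theorem permuteBits_symm (τ : Equiv.Perm (Fin 4)) {n : ℕ} (hn : n < 16) :
    permuteBits τ.symm (permuteBits τ n) = n := by
  rw [← code_vec hn, permuteBits_code, permuteBits_code, code_inj]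
  exact comp_comp_symm τ.symm _

theorem basisValues_act (τ σ : Equiv.Perm (Fin 4)) (f : Vec 4 → Vec 4) :
    basisValues (act τ σ f) = permuteBits τ ∘ basisValues f ∘ σ.symm := by
  funext i
  simp only [basisValues, act, vec_two_pow_comp, Function.comp_apply, permuteBits_code]

/-- The sum of `indicator` over the functions with given values at zero and the unit vectors. -/
noncomputable def sumFrom (y : Fin 4 → ℕ) : ℕ :=
  ∑ f with f 0 = 0 ∧ basisValues f = y, indicator f

/-- The sum of `indicator` over the functions that fix zero and map the set of the unit vectors to
a given set. -/
noncomputable def sumOnto (s : Finset ℕ) : ℕ :=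
  ∑ f with f 0 = 0 ∧ Finset.univ.image (basisValues f) = s, indicator f

theorem sumFrom_comp (y : Fin 4 → ℕ) (σ : Equiv.Perm (Fin 4)) : sumFrom (y ∘ σ) = sumFrom y := by
  refine Finset.sum_nbij' (act 1 σ) (act 1 σ.symm) ?_ ?_ (fun f _ => act_symm_act 1 σ f)
    (fun f _ => act_act_symm 1 σ f) fun f hf => ?_
  · intro f hf
    obtain ⟨-, h0, h⟩ := Finset.mem_filter.mp hf
    refine Finset.mem_filter.mpr ⟨Finset.mem_univ _, act_zero h0 _ _, ?_⟩
    rw [basisValues_act, h]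
    funext i
    -- `permuteBits 1` fixes only numbers below 16, and no bound on `y` is assumed. Hence `y i` is
    -- first exhibited as the code of a vector.
    have hi : basisValues f (σ.symm i) = y i := by
      rw [h, Function.comp_apply, Equiv.apply_symm_apply]
    rw [Function.comp_apply, Function.comp_apply, ← h, hi, ← hi]
    exact permuteBits_code 1 _
  · intro f hf
    obtain ⟨-, h0, h⟩ := Finset.mem_filter.mp hf
    refine Finset.mem_filter.mpr ⟨Finset.mem_univ _, act_zero h0 _ _, ?_⟩
    rw [basisValues_act, ← h]
    funext i
    exact (permuteBits_code _ _).trans rfl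
  · exact (indicator_act (Finset.mem_filter.mp hf).2.1 _ _).symm

/-- The functions are sorted by the order in which the unit vectors take the four values. By
`sumFrom_comp` each of the 24 orders contributes the same. -/
theorem sumOnto_image {y : Fin 4 → ℕ} (hy : Function.Injective y) :
    sumOnto (Finset.univ.image y) = 24 * sumFrom y := by
  classical
  have h : (Finset.univ.filter fun f : Vec 4 → Vec 4 =>
      f 0 = 0 ∧ Finset.univ.image (basisValues f) = Finset.univ.image y) =
      Finset.univ.biUnion fun σ : Equiv.Perm (Fin 4) =>
        Finset.univ.filter fun f : Vec 4 → Vec 4 => f 0 = 0 ∧ basisValues f = y ∘ σ := by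
    ext f
    simp only [Finset.mem_filter, Finset.mem_univ, true_and, Finset.mem_biUnion]
    constructor
    · rintro ⟨h0, h⟩
      have hmem : ∀ i, ∃ j, y j = basisValues f i := by
        intro i
        have := Finset.mem_image_of_mem (basisValues f) (Finset.mem_univ i)
        rw [h] at this
        simpa using this
      choose g hg using hmem
      have hinj : Function.Injective (basisValues f) := by
        rw [← Set.injOn_univ, ← Finset.coe_univ, ← Finset.card_image_iff, h]
        exact Finset.card_image_of_injective _ hy
      have hgi : Function.Injective g := fun i j hij => hinj (by rw [← hg, ← hg, hij])
      exact ⟨Equiv.ofBijective g (Finite.injective_iff_bijective.mp hgi), h0,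
        funext fun i => (hg i).symm⟩
    · rintro ⟨σ, h0, h⟩
      refine ⟨h0, ?_⟩
      rw [h, ← Finset.image_image, Finset.image_univ_of_surjective σ.surjective]
  rw [sumOnto, h, Finset.sum_biUnion]
  · refine (Finset.sum_congr rfl fun σ _ => sumFrom_comp y σ).trans ?_
    rw [Finset.sum_const, smul_eq_mul, Finset.card_univ, Fintype.card_perm]
    rfl
  · intro σ _ τ _ hne
    refine Finset.disjoint_left.mpr fun f hf hf' => hne ?_
    have h1 := (Finset.mem_filter.mp hf).2.2
    have h2 := (Finset.mem_filter.mp hf').2.2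
    exact Equiv.ext fun i => hy (congrFun (h1.symm.trans h2) i)

theorem sumOnto_permuteBits {s : Finset ℕ} (hs : ∀ n ∈ s, n < 16) (τ : Equiv.Perm (Fin 4)) :
    sumOnto (s.image (permuteBits τ)) = sumOnto s := by
  have hact : ∀ (τ : Equiv.Perm (Fin 4)) (f : Vec 4 → Vec 4),
      Finset.univ.image (basisValues (act τ 1 f)) =
        (Finset.univ.image (basisValues f)).image (permuteBits τ) := fun τ f => by
    rw [basisValues_act, Finset.image_image]
    rfl
  symm
  refine Finset.sum_nbij' (act τ 1) (act τ.symm 1) ?_ ?_ (fun f _ => act_symm_act τ 1 f)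
    (fun f _ => act_act_symm τ 1 f) fun f hf => ?_
  · intro f hf
    obtain ⟨-, h0, h⟩ := Finset.mem_filter.mp hf
    exact Finset.mem_filter.mpr ⟨Finset.mem_univ _, act_zero h0 _ _, by rw [hact, h]⟩
  · intro f hf
    obtain ⟨-, h0, h⟩ := Finset.mem_filter.mp hf
    refine Finset.mem_filter.mpr ⟨Finset.mem_univ _, act_zero h0 _ _, ?_⟩
    rw [hact, h, Finset.image_image]
    refine (Finset.image_congr fun n hn => ?_).trans Finset.image_id
    exact permuteBits_symm τ (hs n hn)
  · exact (indicator_act (Finset.mem_filter.mp hf).2.1 _ _).symm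

theorem countFrom_eq {a b c d : ℕ} (ha : a < 16) (hb : b < 16) (hc : c < 16) (hd : d < 16) :
    countFrom a b c d = sumFrom ![a, b, c, d] := by
  have hl : ([0, 16 * 1 + a, 16 * 2 + b, 16 * 4 + c, 16 * 8 + d].reverse ++ []).map (· / 16) =
      [8, 4, 2, 1, 0] := by
    simp only [List.reverse_cons, List.reverse_nil, List.nil_append, List.cons_append,
      List.append_nil, List.map_cons, List.map_nil, List.cons.injEq, and_true]
    omega
  have h := Computes.begin restricts_indicator (k := search) (F := forbidden) (S := 0) (Z := 0)
    (hl ▸ computes_leaf.search restricts_indicator) describes_nil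
    (fun i _ => ⟨Nat.zero_le _, fun _ => rfl⟩) (hl ▸ by decide)
    (fun w hw => by simp only [List.mem_cons, List.not_mem_nil, or_false] at hw; omega) (by simp)
  refine h.trans (Finset.sum_congr (Finset.filter_congr fun f _ => ?_) fun _ _ => rfl)
  simp only [List.reverse_cons, List.reverse_nil, List.nil_append, List.cons_append,
    List.append_nil]
  have h0 : Agrees f [0] ↔ f 0 = 0 := by simp [Agrees, vec_zero]
  have hy : basisValues f = ![a, b, c, d] ↔ code (f (vec 1)) = a ∧ code (f (vec 2)) = b ∧
      code (f (vec 4)) = c ∧ code (f (vec 8)) = d := by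
    simp [funext_iff, Fin.forall_fin_succ, basisValues]
  rw [agrees_cons hd, agrees_cons hc, agrees_cons hb, agrees_cons ha, h0, hy]
  tauto

/-! ### Enumeration of the images of the unit vectors -/

/-- Representatives of the sets of four codes up to permutations of the coordinates, with the
results of the searches that start from them. -/
def representatives : List ((ℕ × ℕ × ℕ × ℕ) × ℕ) :=
  [((3, 5, 6, 7), 18), ((3, 5, 6, 9), 73786976294838206474), ((3, 5, 6, 11), 8),
    ((3, 5, 6, 15), 0), ((3, 5, 7, 9), 4), ((3, 5, 7, 10), 9),
    ((3, 5, 7, 11), 36893488147419103243), ((3, 5, 7, 14), 8), ((3, 5, 7, 15), 8),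
    ((3, 5, 9, 14), 0), ((3, 5, 9, 15), 0), ((3, 5, 10, 12), 0), ((3, 5, 10, 13), 6),
    ((3, 5, 10, 15), 2), ((3, 5, 11, 13), 8), ((3, 5, 11, 14), 4), ((3, 5, 11, 15), 4),
    ((3, 5, 14, 15), 2), ((3, 7, 11, 12), 16), ((3, 7, 11, 13), 2), ((3, 7, 11, 15), 20),
    ((3, 7, 12, 13), 12), ((3, 7, 12, 15), 2), ((3, 7, 13, 14), 2),
    ((3, 7, 13, 15), 73786976294838206476), ((3, 13, 14, 15), 16), ((7, 11, 13, 14), 0),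
    ((7, 11, 13, 15), 0)]

theorem isResult_of_mem_representatives :
    ∀ r ∈ representatives, isResult r = true := by
  refine List.forall_mem_cons.mpr ⟨isResult_3_5_6_7, ?_⟩
  refine List.forall_mem_cons.mpr ⟨isResult_3_5_6_9, ?_⟩
  refine List.forall_mem_cons.mpr ⟨isResult_3_5_6_11, ?_⟩
  refine List.forall_mem_cons.mpr ⟨isResult_3_5_6_15, ?_⟩
  refine List.forall_mem_cons.mpr ⟨isResult_3_5_7_9, ?_⟩
  refine List.forall_mem_cons.mpr ⟨isResult_3_5_7_10, ?_⟩
  refine List.forall_mem_cons.mpr ⟨isResult_3_5_7_11, ?_⟩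
  refine List.forall_mem_cons.mpr ⟨isResult_3_5_7_14, ?_⟩
  refine List.forall_mem_cons.mpr ⟨isResult_3_5_7_15, ?_⟩
  refine List.forall_mem_cons.mpr ⟨isResult_3_5_9_14, ?_⟩
  refine List.forall_mem_cons.mpr ⟨isResult_3_5_9_15, ?_⟩
  refine List.forall_mem_cons.mpr ⟨isResult_3_5_10_12, ?_⟩
  refine List.forall_mem_cons.mpr ⟨isResult_3_5_10_13, ?_⟩
  refine List.forall_mem_cons.mpr ⟨isResult_3_5_10_15, ?_⟩
  refine List.forall_mem_cons.mpr ⟨isResult_3_5_11_13, ?_⟩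
  refine List.forall_mem_cons.mpr ⟨isResult_3_5_11_14, ?_⟩
  refine List.forall_mem_cons.mpr ⟨isResult_3_5_11_15, ?_⟩
  refine List.forall_mem_cons.mpr ⟨isResult_3_5_14_15, ?_⟩
  refine List.forall_mem_cons.mpr ⟨isResult_3_7_11_12, ?_⟩
  refine List.forall_mem_cons.mpr ⟨isResult_3_7_11_13, ?_⟩
  refine List.forall_mem_cons.mpr ⟨isResult_3_7_11_15, ?_⟩
  refine List.forall_mem_cons.mpr ⟨isResult_3_7_12_13, ?_⟩
  refine List.forall_mem_cons.mpr ⟨isResult_3_7_12_15, ?_⟩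
  refine List.forall_mem_cons.mpr ⟨isResult_3_7_13_14, ?_⟩
  refine List.forall_mem_cons.mpr ⟨isResult_3_7_13_15, ?_⟩
  refine List.forall_mem_cons.mpr ⟨isResult_3_13_14_15, ?_⟩
  refine List.forall_mem_cons.mpr ⟨isResult_7_11_13_14, ?_⟩
  refine List.forall_mem_cons.mpr ⟨isResult_7_11_13_15, ?_⟩
  exact List.forall_mem_nil _

/-- The binary code of a set of natural numbers. -/
def setCode (s : Finset ℕ) : ℕ := ∑ n ∈ s, 2 ^ n

/-- The codes of the sets that can be moved to a representative, with the corresponding result. -/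
def orbitTable : List (ℕ × ℕ) :=
  representatives.flatMap fun r => (permsOfList (List.finRange 4)).map fun τ =>
    (2 ^ permuteBits τ r.1.1 + (2 ^ permuteBits τ r.1.2.1 + (2 ^ permuteBits τ r.1.2.2.1 +
      2 ^ permuteBits τ r.1.2.2.2)), r.2)

/-- The codes of the vectors of weight at least two. -/
def heavy : Finset ℕ := {3, 5, 6, 7, 9, 10, 11, 12, 13, 14, 15}

/-- The value that the association list `l` gives to `k`, with the default value `m`. -/
def find (m k : ℕ) (l : List (ℕ × ℕ)) : ℕ :=
  l.foldr (fun r n => bif Nat.beq r.1 k then r.2 else n) m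

/-- The default `2 ^ 80` exceeds the total, so this one equality also shows that each of the 330
sets can be moved to a representative. Multiplying by 24 gives 55296 and 2304. -/
theorem sum_find :
    Nat.beq (∑ s ∈ Finset.powersetCard 4 heavy, find (2 ^ 80) (setCode s) orbitTable)
      (2304 + 96 * 36893488147419103232) = true := by
  decide +kernel

theorem find_mem {m k : ℕ} {l : List (ℕ × ℕ)} (h : find m k l < m) : (k, find m k l) ∈ l := by
  induction l with
  | nil => exact absurd h (lt_irrefl m)
  | cons r l ih =>
    have e : find m k (r :: l) = bif Nat.beq r.1 k then r.2 else find m k l := rfl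
    rw [e] at h ⊢
    cases hk : Nat.beq r.1 k with
    | true =>
      rw [hk] at h
      rw [cond_true, ← Nat.eq_of_beq_eq_true hk]
      exact List.mem_cons_self
    | false =>
      rw [hk, cond_false] at h
      exact List.mem_cons_of_mem _ (ih h)

theorem permuteBits_injOn {τ : Equiv.Perm (Fin 4)} {a b : ℕ} (ha : a < 16) (hb : b < 16)
    (h : permuteBits τ a = permuteBits τ b) : a = b := by
  rw [← permuteBits_symm τ ha, h, permuteBits_symm τ hb]

theorem representatives_spec : ∀ r ∈ representatives,
    Function.Injective ![r.1.1, r.1.2.1, r.1.2.2.1, r.1.2.2.2] ∧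
      ∀ i, ![r.1.1, r.1.2.1, r.1.2.2.1, r.1.2.2.2] i < 16 := by
  decide +kernel

theorem setCode_injective : Function.Injective setCode := Finset.geomSum_injective le_rfl

theorem sumOnto_of_mem_orbitTable {s : Finset ℕ} {n : ℕ} (h : (setCode s, n) ∈ orbitTable) :
    sumOnto s = 24 * n := by
  obtain ⟨r, hr, h⟩ := List.mem_flatMap.mp h
  obtain ⟨τ, -, h⟩ := List.mem_map.mp h
  obtain ⟨hinj, hlt⟩ := representatives_spec r hr
  have hn := isResult_of_mem_representatives r hr
  obtain ⟨⟨a, b, c, d⟩, m⟩ := r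
  obtain ⟨hs, rfl⟩ := Prod.mk.inj h
  have hm : countFrom a b c d = m := Nat.eq_of_beq_eq_true hn
  have hset : s = (Finset.univ.image ![a, b, c, d]).image (permuteBits τ) := by
    apply setCode_injective
    rw [← hs, setCode, Finset.image_image, Finset.sum_image]
    · simp [Fin.sum_univ_succ]
    · exact fun i _ j _ hij => hinj (permuteBits_injOn (hlt i) (hlt j) hij)
  rw [hset, sumOnto_permuteBits, sumOnto_image hinj]
  · exact congrArg (24 * ·) ((countFrom_eq (hlt 0) (hlt 1) (hlt 2) (hlt 3)).symm.trans hm)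
  intro n hn
  obtain ⟨i, -, rfl⟩ := Finset.mem_image.mp hn
  exact hlt i

theorem sum_sumOnto : ∑ s ∈ Finset.powersetCard 4 heavy, sumOnto s =
    55296 + 2304 * 36893488147419103232 := by
  have h := Nat.eq_of_beq_eq_true sum_find
  have hs : ∀ s ∈ Finset.powersetCard 4 heavy,
      sumOnto s = 24 * find (2 ^ 80) (setCode s) orbitTable := fun s hs => by
    refine sumOnto_of_mem_orbitTable (find_mem ?_)
    -- Each summand is at most the total, which is below the default, so the lookup has found an
    -- entry.
    refine lt_of_le_of_lt (Finset.single_le_sum (f := fun s => find (2 ^ 80) (setCode s) orbitTable)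
      (fun _ _ => Nat.zero_le _) hs) ?_
    rw [h]
    norm_num
  rw [Finset.sum_congr rfl hs, ← Finset.mul_sum, h]
  norm_num

/-! ### Assembling the two counts -/

theorem mem_heavy {n : ℕ} (hn : n < 16) (h0 : n ≠ 0) (h : n ∉ [1, 2, 4, 8]) : n ∈ heavy := by
  have key : ∀ n : Fin 16, (n : ℕ) ≠ 0 → (n : ℕ) ∉ [1, 2, 4, 8] → (n : ℕ) ∈ heavy := by decide
  exact key ⟨n, hn⟩ h0 h

/-- The derivative in direction eᵢ takes the value f eᵢ at 0, so `Diff₁ f = 0` excludes weight one;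
injectivity excludes the value 0. -/
theorem IsStrong.basisValues_mem {f : Vec 4 → Vec 4} (h : IsStrong f) (h0 : f 0 = 0) (i : Fin 4) :
    basisValues f i ∈ heavy := by
  have hi : hammingNorm (vec (2 ^ (i : ℕ))) = 1 := by
    revert i
    decide +kernel
  have hne : vec (2 ^ (i : ℕ)) ≠ 0 := fun h => by simp [h] at hi
  refine mem_heavy (code_lt _) (fun hc => hne (h.bijective.injective ?_)) fun hc => ?_
  · rw [h0, ← vec_code (f _)]
    exact (congrArg vec hc).trans vec_zero
  · have := diff₁_eq_zero_iff.mp h.diff₁_eq _ _ hi ((hammingNorm_eq_one _).mpr hc)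
    rw [Finset.card_eq_zero] at this
    refine Finset.notMem_empty (0 : Vec 4) (this ▸ Finset.mem_filter.mpr ⟨Finset.mem_univ _, ?_⟩)
    rw [derivative, zero_add, h0, add_zero]

theorem IsStrong.basisValues_injective {f : Vec 4 → Vec 4} (h : IsStrong f) :
    Function.Injective (basisValues f) := by
  intro i j hij
  have := h.bijective.injective (code_inj.mp hij)
  rw [vec_inj (by fin_cases i <;> norm_num) (by fin_cases j <;> norm_num)] at this
  exact Fin.ext (Nat.pow_right_injective le_rfl this)

theorem sum_indicator : ∑ f with f 0 = 0, indicator f = 55296 + 2304 * 36893488147419103232 := by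
  classical
  have hne : ∀ f, indicator f ≠ 0 → IsStrong f := fun f h => not_not.mp fun h' => h (if_neg h')
  -- The sum is restricted to strong functions because only for them is the image of the unit
  -- vectors known to be a four-element subset of `heavy`.
  rw [← sum_sumOnto, ← Finset.sum_filter_of_ne fun f _ => hne f,
    ← Finset.sum_fiberwise_of_maps_to (t := Finset.powersetCard 4 heavy)
      (g := fun f : Vec 4 → Vec 4 => Finset.univ.image (basisValues f))]
  · refine Finset.sum_congr rfl fun s _ => ?_
    refine Eq.trans ?_ (Finset.sum_filter_of_ne fun f _ => hne f)
    rw [Finset.filter_filter, Finset.filter_filter, Finset.filter_filter]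
    exact Finset.sum_congr (Finset.filter_congr fun f _ => by tauto) fun _ _ => rfl
  · intro f hf
    obtain ⟨hf0, hf⟩ := Finset.mem_filter.mp hf
    have hf0 := (Finset.mem_filter.mp hf0).2
    rw [Finset.mem_powersetCard, Finset.card_image_of_injective _ hf.basisValues_injective]
    refine ⟨fun n hn => ?_, rfl⟩
    obtain ⟨i, -, rfl⟩ := Finset.mem_image.mp hn
    exact hf.basisValues_mem hf0 i

theorem ncard_add_ncard : {f : Vec 4 → Vec 4 | f 0 = 0 ∧ IsStrong f}.ncard +
    36893488147419103232 * {f : Vec 4 → Vec 4 | f 0 = 0 ∧ IsVeryStrong f}.ncard =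
      ∑ f with f 0 = 0, indicator f := by
  classical
  have h : ∀ f, indicator f = (if IsStrong f then 1 else 0) +
      36893488147419103232 * if IsVeryStrong f then 1 else 0 := by
    intro f
    rw [indicator]
    by_cases h1 : IsVeryStrong f
    · simp [h1, h1.isStrong]
    · by_cases h2 : IsStrong f <;> simp [h1, h2]
  have hc : ∀ p : (Vec 4 → Vec 4) → Prop, {f | f 0 = 0 ∧ p f}.ncard =
      ∑ f with f 0 = 0, if p f then 1 else 0 := by
    intro p
    rw [← Finset.card_filter, Finset.filter_filter, ← Set.ncard_coe_finset]
    simp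
  rw [Finset.sum_congr rfl fun f _ => h f, Finset.sum_add_distrib, ← Finset.mul_sum, hc, hc]

end SBox

theorem fact7 :
    {f : SBox.Vec 4 → SBox.Vec 4 | f 0 = 0 ∧ SBox.IsStrong f}.ncard = 55296 ∧
    {f : SBox.Vec 4 → SBox.Vec 4 | f 0 = 0 ∧ SBox.IsVeryStrong f}.ncard = 2304 := by
  have h := SBox.ncard_add_ncard.trans SBox.sum_indicator
  -- There are 16^16 = 2^64 functions in all, so the number of strong ones is less than 2^65 and the
  -- two counts are the base-2^65 digits of the sum.
  have hle : {f : SBox.Vec 4 → SBox.Vec 4 | f 0 = 0 ∧ SBox.IsStrong f}.ncard ≤ 2 ^ 64 := by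
    refine (Set.ncard_le_card _).trans_eq ?_
    simp [Nat.card_eq_fintype_card]
  omega
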